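/- Let $\mathcal X\subseteq\mathbb R^d$ be closed and convex, let $r:\mathcal X\to\mathbb R$ be convex and lower semicontinuous, and let $F:\mathcal X\to\mathbb R^d$ satisfy, for some $L>0$ and $\mu_F,\mu_r\ge 0$ with $\mu_F+\mu_r>0$ and all $x,y\in\mathcal X$, $$\|F(x)-F(y)\|\le L\|x-y\|,\qquad \langle F(x)-F(y),x-y\rangle\ge\mu_F\|x-y\|^2,$$ $$r(y)\ge r(x)+\langle g,y-x\rangle+\tfrac{\mu_r}{2}\|x-y\|^2\quad\text{for all } g\in\partial r(x),$$ where $\partial r(x)$ is the set of all $g\in\mathbb R^d$ with $r(y)\ge r(x)+\langle g,y-x\rangle$ for all $y\in\mathcal X$. Let $x^*\in\mathcal X$ solve the variational inequality $\langle F(x^*),x-x^*\rangle+r(x)-r(x^*)\ge 0$ for all $x\in\mathcal X$. Let $\mathsf Z$ be a Polish space with its Borel $\sigma$-field and let $(Z_i)_{i\ge0}$ be a Markov chain on $\mathsf Z$ (with any initial distribution, in particular the stationary one) with Markov kernel $Q$ and invariant distribution $\pi$, uniformly geometrically ergodic with mixing time $\tau\in\{1,2,\dots\}$: $$\sup_{z,z'\in\mathsf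 Z}\tfrac12\|Q^k(z,\cdot)-Q^k(z',\cdot)\|_{\mathrm{TV}}\le (1/4)^{\lfloor k/\tau\rfloor}\quad\text{for all }k\ge 0 .$$ Let $(x,z)\mapsto F(x,z)\in\mathbb R^d$ be measurable with $\mathbb E_{Z\sim\pi}[F(x,Z)]=F(x)$ and $\|F(x,z)-F(x)\|^2\le\sigma^2+\Delta^2\|x-x^*\|^2$ for all $x\in\mathcal X$, $z\in\mathsf Z$. Let $\mathrm{prox}_{\gamma r}(v)=\arg\min_{y\in\mathcal X}\{\gamma r(y)+\tfrac12\|v-y\|^2\}$. Given $\gamma>0$, $M\ge 2$ and $B\ge1$, the randomized extragradient method starts from $x^0\in\mathcal X$, $T^0=0$ and for $k=0,1,2,\dots$ performs $$x^{k+1/2}=\mathrm{prox}_{\gamma r}\Bigl(x^k-\tfrac{\gamma}{B}\sum_{i=1}^{B}F(x^k,Z_{T^k+i})\Bigr),\qquad T^{k+1/2}=T^k+B,$$ $$g^k=g^k_0+\begin{cases}2^{J_k}\bigl(g^k_{J_k}-g^k_{J_k-1}\bigr),&2^{J_k}\le M,\\0,&\text{otherwise,}\end{cases}\qquad g^k_j=\frac{1}{2^jB}\sum_{i=1}^{2^jB}F(x^{k+1/2},Z_{T^{k+1/2}+i}),$$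 $$x^{k+1}=\mathrm{prox}_{\gamma r}(x^k-\gamma g^k),\qquad T^{k+1}=T^{k+1/2}+2^{J_k}B,$$ where $J_0,J_1,\dots$ are i.i.d. with $\mathbb P(J_k=i)=2^{-i}$, $i=1,2,\dots$, and independent of $(Z_i)$. Then for all constants $a,A>0$ there are constants $c,C>0$, depending only on $a$ and $A$, such that the following holds in every such setting. Let $b\in\{1,2,\dots\}$ and $\gamma>0$ satisfy $$\gamma(\mu_F+\mu_r)\le c,\quad \gamma L\le c,\quad \gamma\Delta^2\bigl(\tau b^{-1}+\tau^2b^{-2}\bigr)\le c(\mu_F+\mu_r),\quad \gamma^2\Delta^2\tau b^{-1}\le c,$$ let $M\ge 2$ satisfy $a\,m\le M\le A\,m$ with $m=\max\{2,\sqrt{\gamma^{-1}(\mu_F+\mu_r)^{-1}}\}$, and let $B=\lceil b\log_2M\rceil$. Then for every $N\ge 0$, $\|x^N-x^*\|^2$ is integrable and $$\mathbb E\|x^N-x^*\|^2\le C\left[\exp\Bigl(-\frac{N(\mu_F+\mu_r)\gamma}{2}\Bigr)\|x^0-x^*\|^2+\frac{\gamma}{\mu_F+\mu_r}\bigl(\sigma^2\tau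 b^{-1}+\sigma^2\tau^2b^{-2}\bigr)\right].$$ -/

import Mathlib

open MeasureTheory ProbabilityTheory
open scoped ENNReal

noncomputable section

namespace MarkovVI

/-! ### Variational inequalities -/

section VI

variable {E : Type*} [NormedAddCommGroup E] [InnerProductSpace ℝ E]

/-- `xs` solves the composite variational inequality on `X`:
`⟪F xs, x - xs⟫ + r x - r xs ≥ 0` for all `x ∈ X`. -/
def IsSolution (X : Set E) (F : E → E) (r : E → ℝ) (xs : E) : Prop :=
  xs ∈ X ∧ ∀ x ∈ X, 0 ≤ inner ℝ (F xs) (x - xs) + r x - r xs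

/-- `F` is `L`-Lipschitz on `X`. -/
def LipschitzOp (X : Set E) (L : ℝ) (F : E → E) : Prop :=
  ∀ x ∈ X, ∀ y ∈ X, ‖F x - F y‖ ≤ L * ‖x - y‖

/-- `F` is `μ`-strongly monotone on `X`. -/
def StronglyMonotoneOp (X : Set E) (μ : ℝ) (F : E → E) : Prop :=
  ∀ x ∈ X, ∀ y ∈ X, μ * ‖x - y‖ ^ 2 ≤ inner ℝ (F x - F y) (x - y)

/-- The subdifferential at `x` of `r` considered as a function on `X`
(that is, of `r` extended by `+∞` outside `X`). -/
def subdiff (X : Set E) (r : E → ℝ) (x : E) : Set E :=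
  {g | ∀ y ∈ X, r x + inner ℝ g (y - x) ≤ r y}

/-- `r` is `μ`-strongly convex on `X`, in terms of its subgradients. -/
def StronglyConvexReg (X : Set E) (μ : ℝ) (r : E → ℝ) : Prop :=
  ∀ x ∈ X, ∀ y ∈ X, ∀ g ∈ subdiff X r x,
    r x + inner ℝ g (y - x) + μ / 2 * ‖x - y‖ ^ 2 ≤ r y

/-- `p` minimizes `y ↦ γ r y + ‖v - y‖² / 2` over `X`. -/
def IsProx (X : Set E) (r : E → ℝ) (γ : ℝ) (v p : E) : Prop :=
  p ∈ X ∧ ∀ y ∈ X, γ * r p + ‖v - p‖ ^ 2 / 2 ≤ γ * r y + ‖v - y‖ ^ 2 / 2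

open Classical in
/-- The proximal operator `prox_{γ r} v = argmin_{y ∈ X} (γ r y + ‖v - y‖² / 2)`. The minimizer
exists and is unique when `X` is closed, convex and nonempty, `γ ≥ 0` and `r` is convex and lower
semicontinuous on `X` (in finite dimension); the value `v` is only a default otherwise. -/
def prox (X : Set E) (r : E → ℝ) (γ : ℝ) (v : E) : E :=
  if h : ∃ p, IsProx X r γ v p then h.choose else v

end VI

/-! ### The randomized extragradient algorithm, for given samples `z` and given levels `j` -/

section Algorithm

variable {E : Type*} [NormedAddCommGroup E] [InnerProductSpace ℝ E] {Z : Type*}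

/-- `n⁻¹ ∑_{i=1}^n G(x, z_{T+i})`. -/
def batchMean (G : E → Z → E) (x : E) (z : ℕ → Z) (T n : ℕ) : E :=
  (n : ℝ)⁻¹ • ∑ i ∈ Finset.Icc 1 n, G x (z (T + i))

/-- The randomized estimator `g = g₀ + 2^j (g_j - g_{j-1})` if `2^j ≤ M` and `g = g₀` otherwise,
where `g_i = 2^{-i} B⁻¹ ∑_{l=1}^{2^i B} G(x, z_{T+l})`. -/
def levelEstimator (G : E → Z → E) (M : ℝ) (B : ℕ) (x : E) (z : ℕ → Z) (T j : ℕ) : E :=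
  batchMean G x z T B +
    if (2 : ℝ) ^ j ≤ M then
      (2 : ℝ) ^ j • (batchMean G x z T (2 ^ j * B) - batchMean G x z T (2 ^ (j - 1) * B))
    else 0

/-- The extrapolated point `x^{k+1/2}`, computed from `x = x^k` and the sample counter `T = T^k`. -/
def extrapolate (X : Set E) (r : E → ℝ) (G : E → Z → E) (γ : ℝ) (B : ℕ) (z : ℕ → Z)
    (x : E) (T : ℕ) : E :=
  prox X r γ (x - γ • batchMean G x z T B)

/-- The pair `(x^k, T^k)` of the `k`-th iterate and the number of samples used so far. -/
def egState (X : Set E) (r : E → ℝ) (G : E → Z → E) (γ M : ℝ) (B : ℕ) (x0 : E)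
    (z : ℕ → Z) (j : ℕ → ℕ) : ℕ → E × ℕ
  | 0 => (x0, 0)
  | k + 1 =>
    let x := (egState X r G γ M B x0 z j k).1
    let T := (egState X r G γ M B x0 z j k).2
    let xh := extrapolate X r G γ B z x T
    (prox X r γ (x - γ • levelEstimator G M B xh z (T + B) (j k)), T + B + 2 ^ j k * B)

/-- The `k`-th iterate `x^k` of the algorithm. -/
def egIterate (X : Set E) (r : E → ℝ) (G : E → Z → E) (γ M : ℝ) (B : ℕ) (x0 : E)
    (z : ℕ → Z) (j : ℕ → ℕ) (k : ℕ) : E :=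
  (egState X r G γ M B x0 z j k).1

end Algorithm

/-! ### Markov chains and mixing -/

section Markov

variable {Z : Type*} [MeasurableSpace Z]

instance isMarkovKernel_pow (Q : Kernel Z Z) [IsMarkovKernel Q] (k : ℕ) :
    IsMarkovKernel (Q ^ k) := by
  induction k with
  | zero => rw [pow_zero]; exact inferInstanceAs (IsMarkovKernel Kernel.id)
  | succ k ih => rw [pow_succ]; exact inferInstanceAs (IsMarkovKernel ((Q ^ k) ∘ₖ Q))

/-- The Dobrushin coefficient `sup_{z,z'} (1/2) ‖Q(z,·) - Q(z',·)‖_TV`, where `‖·‖_TV` is the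
total variation norm (the total mass of the variation of a signed measure). -/
def dobrushin (Q : Kernel Z Z) [IsMarkovKernel Q] : ℝ≥0∞ :=
  ⨆ (z : Z) (z' : Z),
    (1 / 2) * ((Q z).toSignedMeasure - (Q z').toSignedMeasure).totalVariation Set.univ

/-- Uniform geometric ergodicity with mixing time `τ`. -/
def UniformlyErgodic (Q : Kernel Z Z) [IsMarkovKernel Q] (τ : ℕ) : Prop :=
  0 < τ ∧ ∀ k : ℕ, dobrushin (Q ^ k) ≤ (1 / 4) ^ (k / τ)

variable {Ω : Type*} [MeasurableSpace Ω]

/-- `ζ` is, under `P`, a time-homogeneous Markov chain with kernel `Q` (and arbitrary initial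
distribution): `P(ζ_{n+1} ∈ A | ζ_0, …, ζ_n) = Q(ζ_n, A)` almost surely. -/
structure IsMarkovChain (P : Measure Ω) (Q : Kernel Z Z) (ζ : ℕ → Ω → Z) : Prop where
  measurable : ∀ n, Measurable (ζ n)
  markov : ∀ (n : ℕ) (A : Set Z), MeasurableSet A →
    P[(ζ (n + 1) ⁻¹' A).indicator (fun _ => (1 : ℝ)) |
        ⨆ i ∈ Finset.range (n + 1), MeasurableSpace.comap (ζ i) inferInstance]
      =ᵐ[P] fun ω => (Q (ζ n ω)).real A

/-- `J` is, under `P`, a sequence of independent random variables with the geometric distribution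
`P(J_k = i) = 2^{-i}`, `i = 1, 2, …`, independent of the chain `ζ`. -/
structure IsGeometricLevels (P : Measure Ω) (ζ : ℕ → Ω → Z) (J : ℕ → Ω → ℕ) : Prop where
  measurable : ∀ k, Measurable (J k)
  law : ∀ k i : ℕ, 1 ≤ i → P {ω | J k ω = i} = (1 / 2) ^ i
  indep : iIndepFun J P
  indep_chain : IndepFun (fun ω n => ζ n ω) (fun ω k => J k ω) P

end Markov

end MarkovVI

end

/-! Write μ = μF + μr. Let u and g be the estimates of F(x^k) and F(x^{k+1/2}) used in one
iteration. The prox inequalities, strong monotonicity and strong convexity give a pathwise descent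
(`RegularVI.extragradient_descent`): up to constants the squared error drops by γμ‖x^{k+1/2} - x*‖²
+ ‖x^k - x^{k+1/2}‖², at the price of the cross term -2γ⟨x^{k+1/2} - x*, g - F(x^{k+1/2})⟩ and γ²
times the squared noises. So u enters only through its second moment, g through its bias and its
second moment.

Mixing controls both. An average of n consecutive samples has correlation O(τ/n) with anything known
before the samples, and second moment O(τ/n), relative to the noise scale
(`IsNoise.abs_integral_inner_noiseMean_le`, `IsNoise.integral_norm_noiseMean_sq_le`). Averaging over
the random level telescopes, so g has the bias of a batch of more than MB/2 samples. Level i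
contributes 2^{-i} · 4^i · O(τ/(2^i B)) = O(τ/B) to the second moment, and there are at most log₂ M
levels, so B ≥ b log₂ M leaves O(τ/b). By Young's inequality the bias costs γτ²/(μM²B²), and γμM² ≥
a² turns this into O(γ²τ²/b²). The Δ² part of the noise is absorbed into the contraction by the step
size conditions (`contraction_of_descent`). What remains is E_{k+1} ≤ (1 - γμ/2) E_k + Kγ²σ²(τ/b +
τ²/b²), which is iterated.

The sample counter T^k is random, which would make conditioning on the past at time T^k awkward. As
the levels are independent of the chain, they are frozen first: then T^k is a number and x^k a
function of the path up to time T^k. The chain is integrated out for frozen levels, and the levels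
afterwards, with J_k resampled independently (`integral_egIterate_succ_le`). -/

namespace MarkovVI

/-! ### Proximal steps and the deterministic extragradient inequality -/

section Prox

variable {E : Type*} [NormedAddCommGroup E] [InnerProductSpace ℝ E]
  {X : Set E} {F : E → E} {r : E → ℝ} {xs : E} {γ μF μr L : ℝ}

theorem IsSolution.neg_mem_subdiff (h : IsSolution X F r xs) : -F xs ∈ subdiff X r xs := by
  intro y hy
  have := h.2 y hy
  rw [inner_neg_left]
  linarith

theorem exists_isProx [ProperSpace E] (hX : IsClosed X) (hr : LowerSemicontinuousOn r X)
    (hγ : 0 ≤ γ) (hxs : xs ∈ X) {g : E} (hg : g ∈ subdiff X r xs) (v : E) :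
    ∃ p, IsProx X r γ v p := by
  set D := ‖v - xs‖ with hD
  -- The affine minorant of `r` given by `g` makes the objective at least its value at `xs` once `‖v
  -- - y‖ ≥ R`: there `(‖v - y‖² - D²) / 2 ≥ γ‖g‖(‖v - y‖ + D)`. So minimizing over a compact ball
  -- suffices.
  set R := D + 2 * (γ * ‖g‖) with hR
  have hG : 0 ≤ γ * ‖g‖ := by positivity
  have hcomp : IsCompact (X ∩ Metric.closedBall v R) :=
    (isCompact_closedBall v R).inter_left hX
  have hmem : xs ∈ X ∩ Metric.closedBall v R := by
    refine ⟨hxs, ?_⟩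
    rw [Metric.mem_closedBall, dist_comm, dist_eq_norm]
    linarith
  have hlsc : LowerSemicontinuousOn (fun y => γ * r y + ‖v - y‖ ^ 2 / 2)
      (X ∩ Metric.closedBall v R) := by
    refine LowerSemicontinuousOn.add ?_ ?_
    · have hc : Continuous fun t : ℝ => γ * t := by fun_prop
      have hm : Monotone fun t : ℝ => γ * t := fun s t hst => mul_le_mul_of_nonneg_left hst hγ
      exact hc.comp_lowerSemicontinuousOn (hr.mono Set.inter_subset_left) hm
    · exact (Continuous.continuousOn (by fun_prop)).lowerSemicontinuousOn
  obtain ⟨p, hp, hmin⟩ := hlsc.exists_isMinOn ⟨xs, hmem⟩ hcomp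
  refine ⟨p, hp.1, fun y hy => ?_⟩
  by_cases hyR : y ∈ Metric.closedBall v R
  · exact hmin ⟨hy, hyR⟩
  · have h1 : γ * r p + ‖v - p‖ ^ 2 / 2 ≤ γ * r xs + ‖v - xs‖ ^ 2 / 2 := hmin hmem
    refine h1.trans ?_
    rw [Metric.mem_closedBall, dist_comm, dist_eq_norm, not_le] at hyR
    have h2 := mul_le_mul_of_nonneg_left (hg y hy) hγ
    have h3 : -(‖g‖ * (‖v - y‖ + D)) ≤ inner ℝ g (y - xs) := by
      have h4 : ‖y - xs‖ ≤ ‖v - y‖ + D := by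
        rw [norm_sub_rev v y]
        exact norm_sub_le_norm_sub_add_norm_sub y v xs
      have h5 := (abs_le.1 (abs_real_inner_le_norm g (y - xs))).1
      have h6 := mul_le_mul_of_nonneg_left h4 (norm_nonneg g)
      linarith
    have h4 := mul_le_mul_of_nonneg_left h3 hγ
    have hD0 : 0 ≤ D := norm_nonneg _
    nlinarith [mul_nonneg (add_nonneg (norm_nonneg (v - y)) hD0)
      (sub_nonneg.2 hyR.le)]

theorem IsProx.variational (hr : ConvexOn ℝ X r) (hγ : 0 ≤ γ) {v p y : E}
    (hp : IsProx X r γ v p) (hy : y ∈ X) :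
    γ * r p + inner ℝ (v - p) (y - p) ≤ γ * r y := by
  by_contra! hlt
  set δ := γ * r p + inner ℝ (v - p) (y - p) - γ * r y with hδ
  have hδ0 : 0 < δ := by linarith
  set n := ‖y - p‖ ^ 2 with hn
  have hn0 : 0 ≤ n := by positivity
  have key : ∀ t : ℝ, 0 < t → t ≤ 1 → δ ≤ t * n / 2 := by
    intro t ht ht1
    have hmem : (1 - t) • p + t • y ∈ X :=
      hr.1 hp.1 hy (by linarith) ht.le (by ring)
    have h1 := hp.2 _ hmem
    have h2 := mul_le_mul_of_nonneg_left
      (hr.2 hp.1 hy (by linarith : 0 ≤ 1 - t) ht.le (by ring)) hγ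
    simp only [smul_eq_mul] at h2
    have h3 : v - ((1 - t) • p + t • y) = (v - p) - t • (y - p) := by module
    rw [h3, norm_sub_sq_real (v - p), inner_smul_right, norm_smul, mul_pow, Real.norm_eq_abs,
      sq_abs] at h1
    have h4 : t * δ ≤ t * (t * n / 2) := by
      rw [hδ, hn]
      nlinarith
    exact le_of_mul_le_mul_left h4 ht
  -- A `t` small enough to force `δ ≤ δ / 2`; the `+ 1` covers `n = 0`.
  have h := key (min 1 (δ / (n + 1))) (by positivity) (min_le_left _ _)
  have h' : min 1 (δ / (n + 1)) * n / 2 ≤ δ / (n + 1) * (n + 1) / 2 := by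
    gcongr
    · exact min_le_right _ _
    · linarith
  rw [div_mul_cancel₀ _ (by positivity)] at h'
  linarith

/-- Testing each inequality at the other point and adding gives firm nonexpansiveness, `‖p - q‖² ≤
⟪v - w, p - q⟫`. Phrased through the inequalities rather than `prox`, it applies directly to `xs`,
which satisfies them with input `xs - γ • F xs`. -/
theorem norm_sub_le_of_variational {v w p q : E} (hp : p ∈ X) (hq : q ∈ X)
    (h1 : ∀ y ∈ X, γ * r p + inner ℝ (v - p) (y - p) ≤ γ * r y)
    (h2 : ∀ y ∈ X, γ * r q + inner ℝ (w - q) (y - q) ≤ γ * r y) :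
    ‖p - q‖ ≤ ‖v - w‖ := by
  have h3 := h1 q hq
  have h4 := h2 p hp
  have h5 : ‖p - q‖ ^ 2 = inner ℝ (v - w) (p - q) + inner ℝ (v - p) (q - p)
      + inner ℝ (w - q) (p - q) := by
    rw [← neg_sub p q, inner_neg_right, ← real_inner_self_eq_norm_sq]
    simp only [inner_sub_left]
    ring
  have h6 := real_inner_le_norm (v - w) (p - q)
  by_contra! hlt
  have h7 : 0 < ‖p - q‖ := (norm_nonneg _).trans_lt hlt
  nlinarith

/-- The standing assumptions on the variational inequality. -/
structure RegularVI (X : Set E) (F : E → E) (r : E → ℝ) (xs : E) (L μF μr : ℝ) : Prop where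
  isClosed : IsClosed X
  convexOn : ConvexOn ℝ X r
  lsc : LowerSemicontinuousOn r X
  lipschitz : LipschitzOp X L F
  monotone : StronglyMonotoneOp X μF F
  stronglyConvex : StronglyConvexReg X μr r
  isSolution : IsSolution X F r xs

namespace RegularVI

theorem mem (h : RegularVI X F r xs L μF μr) : xs ∈ X := h.isSolution.1

variable [ProperSpace E] (h : RegularVI X F r xs L μF μr)
include h

theorem isProx_prox (hγ : 0 ≤ γ) (v : E) : IsProx X r γ v (prox X r γ v) := by
  have hex := exists_isProx h.isClosed h.lsc hγ h.mem h.isSolution.neg_mem_subdiff v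
  rw [prox, dif_pos hex]
  exact hex.choose_spec

theorem prox_mem (hγ : 0 ≤ γ) (v : E) : prox X r γ v ∈ X := (h.isProx_prox hγ v).1

theorem prox_variational (hγ : 0 ≤ γ) (v : E) :
    ∀ y ∈ X, γ * r (prox X r γ v) + inner ℝ (v - prox X r γ v) (y - prox X r γ v) ≤ γ * r y :=
  fun _ hy => (h.isProx_prox hγ v).variational h.convexOn hγ hy

theorem norm_prox_sub_prox_le (hγ : 0 ≤ γ) (v w : E) :
    ‖prox X r γ v - prox X r γ w‖ ≤ ‖v - w‖ :=
  norm_sub_le_of_variational (h.prox_mem hγ v) (h.prox_mem hγ w) (h.prox_variational hγ v)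
    (h.prox_variational hγ w)

theorem continuous_prox (hγ : 0 ≤ γ) : Continuous (prox X r γ) := by
  refine (LipschitzWith.of_dist_le_mul (K := 1) fun v w => ?_).continuous
  simpa [dist_eq_norm] using h.norm_prox_sub_prox_le hγ v w

/-- The solution is a fixed point of the exact prox step, so nonexpansiveness applies. The bound
serves only to keep the iterates in a ball that does not depend on the path. -/
theorem norm_prox_sub_solution_le (hγ : 0 ≤ γ) (x g : E) :
    ‖prox X r γ (x - γ • g) - xs‖ ≤ ‖x - xs‖ + γ * ‖g - F xs‖ := by
  have h1 : ‖prox X r γ (x - γ • g) - xs‖ ≤ ‖(x - γ • g) - (xs - γ • F xs)‖ := by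
    refine norm_sub_le_of_variational (h.prox_mem hγ _) h.mem (h.prox_variational hγ _) ?_
    intro y hy
    have := mul_le_mul_of_nonneg_left (h.isSolution.neg_mem_subdiff y hy) hγ
    rw [sub_sub_cancel_left, ← smul_neg, inner_smul_left]
    simpa [mul_add] using this
  refine h1.trans ?_
  have h2 : (x - γ • g) - (xs - γ • F xs) = (x - xs) - γ • (g - F xs) := by module
  rw [h2]
  refine (norm_sub_le _ _).trans ?_
  rw [norm_smul, Real.norm_of_nonneg hγ]

/-- By the optimality condition `γ⁻¹ • (v - p)` is a subgradient at the prox point `p`; strong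
convexity at that subgradient then adds the quadratic term. -/
theorem prox_strong_variational (hγ : 0 < γ) (v : E) {y : E} (hy : y ∈ X) :
    γ * r (prox X r γ v) + inner ℝ (v - prox X r γ v) (y - prox X r γ v)
      + γ * μr / 2 * ‖prox X r γ v - y‖ ^ 2 ≤ γ * r y := by
  have hsub : γ⁻¹ • (v - prox X r γ v) ∈ subdiff X r (prox X r γ v) := by
    intro z hz
    have h1 := h.prox_variational hγ.le v z hz
    rw [real_inner_smul_left]
    refine le_of_mul_le_mul_left ?_ hγ
    rw [mul_add, mul_inv_cancel_left₀ hγ.ne']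
    exact h1
  have h2 := h.stronglyConvex _ (h.prox_mem hγ.le v) y hy _ hsub
  rw [real_inner_smul_left] at h2
  have h3 := mul_le_mul_of_nonneg_left h2 hγ.le
  rw [mul_add, mul_add, mul_inv_cancel_left₀ hγ.ne'] at h3
  linarith

/-- The basic descent inequality of the extragradient method with inexact operator values. -/
theorem extragradient_descent (hγ : 0 < γ) (hμr : 0 ≤ μr) {x : E} (hx : x ∈ X) (u g : E) :
    ‖prox X r γ (x - γ • g) - xs‖ ^ 2 ≤ ‖x - xs‖ ^ 2
      - (1 - 3 * (γ * L) ^ 2) * ‖x - prox X r γ (x - γ • u)‖ ^ 2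
      - γ * (2 * μF + μr) * ‖prox X r γ (x - γ • u) - xs‖ ^ 2
      - 2 * γ * inner ℝ (prox X r γ (x - γ • u) - xs) (g - F (prox X r γ (x - γ • u)))
      + 3 * γ ^ 2 * ‖u - F x‖ ^ 2
      + 3 * γ ^ 2 * ‖g - F (prox X r γ (x - γ • u))‖ ^ 2 := by
  -- The final prox step is tested at `xs`, the extrapolation step at the final point. Together with
  -- `a3` and `a4` the values of `r` cancel; monotonicity contributes `2γμF` and strong convexity at
  -- `xs` contributes `γμr` in front of `‖q - xs‖²`.
  have a1 := h.prox_strong_variational hγ (x - γ • g) h.mem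
  have hpX := h.prox_mem hγ.le (x - γ • g)
  have a2 := h.prox_strong_variational hγ (x - γ • u) hpX
  have hqX := h.prox_mem hγ.le (x - γ • u)
  set p := prox X r γ (x - γ • g)
  set q := prox X r γ (x - γ • u)
  have a3 := mul_le_mul_of_nonneg_left
    (h.stronglyConvex xs h.mem q hqX _ h.isSolution.neg_mem_subdiff) hγ.le
  have a4 := mul_le_mul_of_nonneg_left (h.monotone q hqX xs h.mem) hγ.le
  -- The extragradient mechanism: the mismatch between the two operator values is paid for by the
  -- term `‖p - q‖²` of `e2`.
  have a5 : 2 * γ * inner ℝ (u - g) (p - q) ≤ γ ^ 2 * ‖u - g‖ ^ 2 + ‖p - q‖ ^ 2 := by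
    have := norm_sub_sq_real (γ • (u - g)) (p - q)
    rw [norm_smul, mul_pow, Real.norm_eq_abs, sq_abs, real_inner_smul_left] at this
    nlinarith [sq_nonneg ‖γ • (u - g) - (p - q)‖]
  have a6 : ‖u - g‖ ^ 2 ≤ 3 * ‖u - F x‖ ^ 2 + 3 * (L * ‖x - q‖) ^ 2 + 3 * ‖g - F q‖ ^ 2 := by
    have b1 : ‖u - g‖ ≤ ‖u - F x‖ + L * ‖x - q‖ + ‖g - F q‖ := by
      have : u - g = (u - F x) + (F x - F q) - (g - F q) := by abel
      rw [this]
      refine (norm_sub_le _ _).trans (add_le_add_left ((norm_add_le _ _).trans ?_) _)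
      exact add_le_add_right (h.lipschitz x hx q hqX) _
    have b2 := pow_le_pow_left₀ (norm_nonneg (u - g)) b1 2
    nlinarith [sq_nonneg (‖u - F x‖ - L * ‖x - q‖), sq_nonneg (‖u - F x‖ - ‖g - F q‖),
      sq_nonneg (L * ‖x - q‖ - ‖g - F q‖)]
  have a7 := mul_le_mul_of_nonneg_left a6 (sq_nonneg γ)
  have e1 : ‖x - xs‖ ^ 2 = ‖x - p‖ ^ 2 + ‖p - xs‖ ^ 2 - 2 * inner ℝ (x - p) (xs - p) := by
    have : x - xs = (x - p) - (xs - p) := by abel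
    rw [this, norm_sub_sq_real, norm_sub_rev xs p]
    ring
  have e2 : ‖x - p‖ ^ 2 = ‖x - q‖ ^ 2 + ‖p - q‖ ^ 2 - 2 * inner ℝ (x - q) (p - q) := by
    have : x - p = (x - q) - (p - q) := by abel
    rw [this, norm_sub_sq_real]
    ring
  have e3 : inner ℝ (x - γ • g - p) (xs - p) = inner ℝ (x - p) (xs - p)
      - γ * inner ℝ g (xs - p) := by
    rw [sub_right_comm, inner_sub_left, real_inner_smul_left]
  have e4 : inner ℝ (x - γ • u - q) (p - q) = inner ℝ (x - q) (p - q)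
      - γ * inner ℝ u (p - q) := by
    rw [sub_right_comm, inner_sub_left, real_inner_smul_left]
  have e5 : inner ℝ g (xs - p) + inner ℝ u (p - q) = inner ℝ (u - g) (p - q)
      - inner ℝ (q - xs) (g - F q) - inner ℝ (F q - F xs) (q - xs) + inner ℝ (-F xs) (q - xs) := by
    have : inner ℝ (q - xs) (g - F q) = inner ℝ g (q - xs) - inner ℝ (F q) (q - xs) := by
      rw [real_inner_comm, inner_sub_left]
    rw [this]
    simp only [inner_sub_left, inner_sub_right, inner_neg_left]
    ring
  rw [norm_sub_rev q p] at a2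
  rw [norm_sub_rev xs q] at a3
  have n1 : 0 ≤ γ * μr / 2 * ‖p - q‖ ^ 2 := by positivity
  have n2 : 0 ≤ γ * μr / 2 * ‖p - xs‖ ^ 2 := by positivity
  have e5' := congrArg (fun t => γ * t) e5
  simp only [mul_add, mul_sub] at e5'
  rw [e3] at a1
  rw [e4] at a2
  nlinarith

end RegularVI

end Prox

/-! ### Total variation and convergence of expectations to equilibrium -/

section TotalVariation

variable {Z : Type*} [MeasurableSpace Z]

theorem integrable_of_abs_le {μ : Measure Z} [IsFiniteMeasure μ] {f : Z → ℝ} (hf : Measurable f)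
    {s : ℝ} (hs : ∀ z, |f z| ≤ s) : Integrable f μ :=
  Integrable.of_bound hf.aestronglyMeasurable s (Filter.Eventually.of_forall hs)

theorem abs_integral_sub_le_totalVariation {μ ν : Measure Z} [IsFiniteMeasure μ]
    [IsFiniteMeasure ν] {f : Z → ℝ} (hf : Measurable f) {s : ℝ} (hs : ∀ z, |f z| ≤ s) :
    |∫ z, f z ∂μ - ∫ z, f z ∂ν| ≤
      s * ((μ.toSignedMeasure - ν.toSignedMeasure).totalVariation Set.univ).toReal := by
  set κ := μ.toSignedMeasure - ν.toSignedMeasure with hκ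
  set p := κ.toJordanDecomposition.posPart with hp
  set n := κ.toJordanDecomposition.negPart with hn
  -- The Jordan decomposition of `μ - ν` is rearranged into an identity of positive measures, so
  -- that ordinary integrals can be compared.
  have hsum : μ + n = ν + p := by
    refine Measure.ext fun A hA => ?_
    have h1 := κ.apply_eq_posPart_real_sub_negPart_real hA
    rw [hκ, sub_apply, Measure.toSignedMeasure_apply_measurable hA,
      Measure.toSignedMeasure_apply_measurable hA, ← hκ, ← hp, ← hn] at h1
    have h2 : (μ + n).real A = (ν + p).real A := by
      rw [measureReal_add_apply, measureReal_add_apply]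
      linarith
    rwa [measureReal_def, measureReal_def, ENNReal.toReal_eq_toReal_iff' (measure_ne_top _ _)
      (measure_ne_top _ _)] at h2
  have hint : ∀ (ρ : Measure Z) [IsFiniteMeasure ρ], Integrable f ρ :=
    fun ρ _ => integrable_of_abs_le hf hs
  have h3 : ∫ z, f z ∂(μ + n) = ∫ z, f z ∂(ν + p) := by rw [hsum]
  rw [integral_add_measure (hint _) (hint _), integral_add_measure (hint _) (hint _)] at h3
  have h4 : ∫ z, f z ∂μ - ∫ z, f z ∂ν = ∫ z, f z ∂p - ∫ z, f z ∂n := by linarith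
  have h5 : ∀ (ρ : Measure Z) [IsFiniteMeasure ρ], |∫ z, f z ∂ρ| ≤ s * ρ.real Set.univ :=
    fun ρ _ => norm_integral_le_of_norm_le_const (f := f) (Filter.Eventually.of_forall hs)
  have h6 : (κ.totalVariation Set.univ).toReal = p.real Set.univ + n.real Set.univ := by
    rw [SignedMeasure.totalVariation, ← measureReal_def, measureReal_add_apply]
  rw [h4, h6, mul_add]
  exact (abs_sub _ _).trans (add_le_add (h5 p) (h5 n))

theorem invariant_pow {Q : Kernel Z Z} {π : Measure Z} (hπ : Kernel.Invariant Q π) (k : ℕ) :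
    Kernel.Invariant (Q ^ k) π := by
  induction k with
  | zero => rw [pow_zero]; exact Measure.id_comp
  | succ k ih => rw [pow_succ]; exact ih.comp hπ

variable {Q : Kernel Z Z} [IsMarkovKernel Q] {τ : ℕ}

theorem UniformlyErgodic.abs_integral_sub_le (hQ : UniformlyErgodic Q τ) {f : Z → ℝ}
    (hf : Measurable f) {s : ℝ} (hs : ∀ z, |f z| ≤ s) (k : ℕ) (z z' : Z) :
    |∫ y, f y ∂((Q ^ k) z) - ∫ y, f y ∂((Q ^ k) z')| ≤ 2 * (1 / 4) ^ (k / τ) * s := by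
  have h1 : (1 / 2 : ℝ≥0∞) * (((Q ^ k) z).toSignedMeasure
      - ((Q ^ k) z').toSignedMeasure).totalVariation Set.univ ≤ (1 / 4) ^ (k / τ) :=
    (le_iSup₂ (f := fun z z' => (1 / 2 : ℝ≥0∞) * (((Q ^ k) z).toSignedMeasure
      - ((Q ^ k) z').toSignedMeasure).totalVariation Set.univ) z z').trans (hQ.2 k)
  have h2 := ENNReal.toReal_mono (by finiteness) h1
  simp only [ENNReal.toReal_mul, ENNReal.toReal_div, ENNReal.toReal_pow, ENNReal.toReal_one,
    ENNReal.toReal_ofNat] at h2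
  have hs0 : 0 ≤ s := (abs_nonneg _).trans (hs z)
  refine (abs_integral_sub_le_totalVariation hf hs).trans ?_
  nlinarith

/-- By invariance, averaging the second starting point over `π` replaces the comparison expectation
by `∫ f ∂π = 0`. -/
theorem UniformlyErgodic.abs_integral_le (hQ : UniformlyErgodic Q τ) {π : Measure Z}
    [IsProbabilityMeasure π] (hπ : Kernel.Invariant Q π) {f : Z → ℝ}
    (hf : Measurable f) {s : ℝ} (hs : ∀ z, |f z| ≤ s) (h0 : ∫ z, f z ∂π = 0) (k : ℕ) (z : Z) :
    |∫ y, f y ∂((Q ^ k) z)| ≤ 2 * (1 / 4) ^ (k / τ) * s := by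
  have hint : ∀ (ρ : Measure Z) [IsFiniteMeasure ρ], Integrable f ρ :=
    fun ρ _ => integrable_of_abs_le hf hs
  have hm : Measurable fun z' => ∫ y, f y ∂((Q ^ k) z') :=
    (hf.stronglyMeasurable.integral_kernel).measurable
  have h1 : ∫ z', ∫ y, f y ∂((Q ^ k) z') ∂π = 0 := by
    rw [← h0]
    have e : ((Q ^ k) ∘ₖ Kernel.const Unit π) () = π := by
      rw [Kernel.comp_apply, Kernel.const_apply, (invariant_pow hπ k).def]
    have h2 := Kernel.integral_comp (η := Q ^ k) (κ := Kernel.const Unit π) (a := ()) (f := f)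
      (by rw [e]; exact hint π)
    rw [e, Kernel.const_apply] at h2
    exact h2.symm
  have hm' : Integrable (fun z' => ∫ y, f y ∂((Q ^ k) z')) π := by
    refine integrable_of_abs_le hm (s := s) fun z' => ?_
    have := norm_integral_le_of_norm_le_const (μ := (Q ^ k) z') (f := f)
      (Filter.Eventually.of_forall hs)
    simpa using this
  have h2 : ∫ y, f y ∂((Q ^ k) z)
      = ∫ z', (∫ y, f y ∂((Q ^ k) z) - ∫ y, f y ∂((Q ^ k) z')) ∂π := by
    rw [integral_sub (integrable_const _) hm', h1]
    simp
  rw [h2]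
  have := norm_integral_le_of_norm_le_const (μ := π)
    (f := fun z' => ∫ y, f y ∂((Q ^ k) z) - ∫ y, f y ∂((Q ^ k) z'))
    (Filter.Eventually.of_forall fun z' => hQ.abs_integral_sub_le hf hs k z z')
  simpa using this

end TotalVariation

/-! ### Functions of a finite piece of the path -/

section Path

variable {Z : Type*}

/-- The path `z` frozen after time `n`. -/
def stopAt (n : ℕ) (z : ℕ → Z) : ℕ → Z := fun i => z (min i n)

/-- `f` depends only on the first `n + 1` coordinates of the path. -/
def DeterminedBy {β : Type*} (n : ℕ) (f : (ℕ → Z) → β) : Prop := ∀ z, f (stopAt n z) = f z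

theorem stopAt_stopAt {n m : ℕ} (h : n ≤ m) (z : ℕ → Z) : stopAt n (stopAt m z) = stopAt n z := by
  funext i
  simp only [stopAt]
  congr 1
  omega

theorem DeterminedBy.mono {β : Type*} {n m : ℕ} {f : (ℕ → Z) → β} (hf : DeterminedBy n f)
    (h : n ≤ m) : DeterminedBy m f := fun z => by
  rw [← hf (stopAt m z), stopAt_stopAt h, hf]

theorem determinedBy_apply {n i : ℕ} (h : i ≤ n) : DeterminedBy n (fun z : ℕ → Z => z i) :=
  fun z => by simp [stopAt, h]

theorem measurable_stopAt [MeasurableSpace Z] (n : ℕ) :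
    Measurable (stopAt n : (ℕ → Z) → (ℕ → Z)) :=
  measurable_pi_lambda _ fun i => measurable_pi_apply (min i n)

end Path

/-! ### Markov property and decorrelation -/

section Chain

variable {Z : Type*} [MeasurableSpace Z] {Q : Kernel Z Z}
  {Ω : Type*} [MeasurableSpace Ω] {P : Measure Ω} {ζ : ℕ → Ω → Z}

theorem IsMarkovChain.measurable_path (hζ : IsMarkovChain P Q ζ) :
    Measurable (fun ω n => ζ n ω) := measurable_pi_lambda _ hζ.measurable

variable [IsMarkovKernel Q] [IsProbabilityMeasure P]

theorem IsMarkovChain.map_restrict_succ (hζ : IsMarkovChain P Q ζ) (n : ℕ) {S : Set Ω}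
    (hS : MeasurableSet[⨆ i ∈ Finset.range (n + 1),
      MeasurableSpace.comap (ζ i) inferInstance] S) :
    (P.restrict S).map (ζ (n + 1)) = ((P.restrict S).map (ζ n)).bind Q := by
  have hle : (⨆ i ∈ Finset.range (n + 1),
      MeasurableSpace.comap (ζ i) inferInstance) ≤ (inferInstance : MeasurableSpace Ω) :=
    iSup₂_le fun i _ => (hζ.measurable i).comap_le
  have hS' := hle _ hS
  refine Measure.ext fun A hA => ?_
  have hA' := hζ.measurable (n + 1) hA
  rw [Measure.map_apply (hζ.measurable _) hA, Measure.bind_apply hA Q.aemeasurable,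
    lintegral_map (Q.measurable_coe hA) (hζ.measurable n), Measure.restrict_apply hA']
  have h1 := setIntegral_condExp hle (μ := P)
    (f := (ζ (n + 1) ⁻¹' A).indicator (fun _ => (1 : ℝ)))
    ((integrable_const _).indicator hA') hS
  rw [setIntegral_congr_ae hS' ((hζ.markov n A hA).mono fun ω h _ => h),
    integral_indicator hA', integral_const, smul_eq_mul, mul_one, measureReal_restrict_apply_univ,
    measureReal_restrict_apply hA'] at h1
  simp only [measureReal_def] at h1
  have hQm : Measurable fun ω => Q (ζ n ω) A := (Q.measurable_coe hA).comp (hζ.measurable n)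
  rw [integral_toReal hQm.aemeasurable
    (Filter.Eventually.of_forall fun ω => measure_lt_top _ _)] at h1
  rw [ENNReal.toReal_eq_toReal_iff' _ (measure_ne_top _ _)] at h1
  · exact h1.symm
  · refine ((lintegral_mono fun ω => prob_le_one (μ := Q (ζ n ω))).trans_lt ?_).ne
    simp

/-- An event of the past of time `n` also belongs to the past of every later time, so the one-step
identity can be iterated. -/
theorem IsMarkovChain.map_restrict_add (hζ : IsMarkovChain P Q ζ) (n k : ℕ) {S : Set Ω}
    (hS : MeasurableSet[⨆ i ∈ Finset.range (n + 1),
      MeasurableSpace.comap (ζ i) inferInstance] S) :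
    (P.restrict S).map (ζ (n + k)) = ((P.restrict S).map (ζ n)).bind (Q ^ k) := by
  induction k with
  | zero => rw [pow_zero]; exact Measure.id_comp.symm
  | succ k ih =>
    have hle : (⨆ i ∈ Finset.range (n + 1), MeasurableSpace.comap (ζ i) inferInstance) ≤
        ⨆ i ∈ Finset.range (n + k + 1), MeasurableSpace.comap (ζ i) inferInstance :=
      biSup_mono fun i hi => by rw [Finset.mem_range] at *; omega
    rw [← add_assoc, hζ.map_restrict_succ (n + k) (hle _ hS), ih, pow_succ']
    exact Measure.comp_assoc

/-- This is the Markov property with the whole past retained: given the path frozen at time `n`, the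
state `k` steps later has law `Q ^ k` started from the current state. Rectangles suffice, and for
these it is `map_restrict_add` on an event of the past. -/
theorem IsMarkovChain.map_stopAt_prod (hζ : IsMarkovChain P Q ζ) (n k : ℕ) :
    P.map (fun ω => (stopAt n (fun i => ζ i ω), ζ (n + k) ω)) =
      (P.map fun ω => stopAt n (fun i => ζ i ω)) ⊗ₘ
        ((Q ^ k).comap (fun p : ℕ → Z => p n) (measurable_pi_apply n)) := by
  have hm : Measurable fun ω => stopAt n (fun i => ζ i ω) :=
    (measurable_stopAt n).comp hζ.measurable_path
  have : IsProbabilityMeasure (P.map fun ω => stopAt n (fun i => ζ i ω)) :=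
    Measure.isProbabilityMeasure_map hm.aemeasurable
  refine Measure.ext_prod fun {S A} hS hA => ?_
  have hmS : MeasurableSet[⨆ i ∈ Finset.range (n + 1),
      MeasurableSpace.comap (ζ i) inferInstance] ((fun ω => stopAt n (fun i => ζ i ω)) ⁻¹' S) := by
    refine (?_ : Measurable[⨆ i ∈ Finset.range (n + 1),
      MeasurableSpace.comap (ζ i) inferInstance] fun ω => stopAt n (fun i => ζ i ω)) hS
    refine @measurable_pi_lambda _ _ _ (_) _ _ fun i => ?_
    have : Measurable[MeasurableSpace.comap (ζ (min i n)) inferInstance] (ζ (min i n)) :=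
      comap_measurable _
    refine this.mono ?_ le_rfl
    exact le_iSup₂_of_le (min i n) (by rw [Finset.mem_range]; omega) le_rfl
  have h1 := congrArg (fun μ => μ A) (hζ.map_restrict_add n k hmS)
  rw [Measure.map_apply (hζ.measurable _) hA, Measure.bind_apply hA (Q ^ k).aemeasurable,
    lintegral_map ((Q ^ k).measurable_coe hA) (hζ.measurable n),
    Measure.restrict_apply (hζ.measurable _ hA)] at h1
  rw [Measure.map_apply (hm.prodMk (hζ.measurable _)) (hS.prod hA),
    Measure.compProd_apply_prod hS hA, setLIntegral_map hS
      (Kernel.measurable_coe _ hA) hm]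
  have h2 : (fun ω => (stopAt n (fun i => ζ i ω), ζ (n + k) ω)) ⁻¹' S ×ˢ A
      = ζ (n + k) ⁻¹' A ∩ (fun ω => stopAt n (fun i => ζ i ω)) ⁻¹' S := by
    ext ω; simp [and_comm]
  rw [h2, h1]
  simp [stopAt]

/-- Decorrelation: the mean of a function of the past up to time `n` and of the state at time
`n + k`, centred for the invariant law in the second variable, decays geometrically in `k`. -/
theorem IsMarkovChain.abs_integral_le (hζ : IsMarkovChain P Q ζ) {τ : ℕ}
    (hQ : UniformlyErgodic Q τ) {π : Measure Z} [IsProbabilityMeasure π]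
    (hπ : Kernel.Invariant Q π) {n : ℕ} (k : ℕ) {f : (ℕ → Z) → Z → ℝ} {s : (ℕ → Z) → ℝ} {K : ℝ}
    (hf : Measurable (Function.uncurry f)) (hs : Measurable s)
    (hfn : DeterminedBy n f)
    (hfs : ∀ p z, |f p z| ≤ s p) (hsK : ∀ p, s p ≤ K) (h0 : ∀ p, ∫ z, f p z ∂π = 0) :
    |∫ ω, f (fun i => ζ i ω) (ζ (n + k) ω) ∂P| ≤
      2 * (1 / 4) ^ (k / τ) * ∫ ω, s (fun i => ζ i ω) ∂P := by
  have hm : Measurable fun ω => stopAt n (fun i => ζ i ω) :=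
    (measurable_stopAt n).comp hζ.measurable_path
  have : IsProbabilityMeasure (P.map fun ω => stopAt n (fun i => ζ i ω)) :=
    Measure.isProbabilityMeasure_map hm.aemeasurable
  -- Since `f` only sees the frozen path, the state at time `n + k` can be integrated out with the
  -- past held fixed.
  have e1 : ∫ ω, f (fun i => ζ i ω) (ζ (n + k) ω) ∂P
      = ∫ ω, ∫ y, f (fun i => ζ i ω) y ∂((Q ^ k) (ζ n ω)) ∂P := by
    have h1 : ∫ x, Function.uncurry f x
        ∂(P.map (fun ω => (stopAt n (fun i => ζ i ω), ζ (n + k) ω)))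
        = ∫ ω, f (fun i => ζ i ω) (ζ (n + k) ω) ∂P := by
      rw [integral_map (hm.prodMk (hζ.measurable _)).aemeasurable hf.aestronglyMeasurable]
      simp only [Function.uncurry, hfn _]
    rw [← h1, hζ.map_stopAt_prod, Measure.integral_compProd]
    · rw [integral_map hm.aemeasurable]
      · simp only [Function.uncurry, Kernel.comap_apply]
        refine integral_congr_ae (Filter.Eventually.of_forall fun ω => ?_)
        simp only [hfn _]
        simp [stopAt]
      · exact (hf.stronglyMeasurable.integral_kernel_prod_right').aestronglyMeasurable
    · exact integrable_of_abs_le hf fun x => (hfs _ _).trans (hsK x.1)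
  rw [e1, ← integral_const_mul]
  have hsi : Integrable (fun ω => s (fun i => ζ i ω)) P := by
    refine integrable_of_abs_le (s := K) (hs.comp hζ.measurable_path) fun ω => ?_
    have := (abs_nonneg _).trans (hfs (fun i => ζ i ω) (ζ 0 ω))
    rw [abs_of_nonneg this]
    exact hsK _
  refine norm_integral_le_of_norm_le
    (f := fun ω => ∫ y, f (fun i => ζ i ω) y ∂((Q ^ k) (ζ n ω))) (hsi.const_mul _)
    (Filter.Eventually.of_forall fun ω => ?_)
  exact hQ.abs_integral_le hπ (hf.comp measurable_prodMk_left) (hfs _) (h0 _) k _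

end Chain

/-! ### Geometric sums over blocks of length `τ` -/

section GeometricSum

theorem sum_range_geometric_div_le {τ : ℕ} (hτ : 0 < τ) (K : ℕ) :
    ∑ k ∈ Finset.range K, (1 / 4 : ℝ) ^ (k / τ) ≤ 2 * τ := by
  induction K using Nat.strong_induction_on with
  | _ K ih =>
    rcases le_total K τ with h | h
    · have h1 : ∑ k ∈ Finset.range K, (1 / 4 : ℝ) ^ (k / τ) ≤ ∑ k ∈ Finset.range K, (1 : ℝ) :=
        Finset.sum_le_sum fun k _ => pow_le_one₀ (by norm_num) (by norm_num)
      have h2 : (K : ℝ) ≤ τ := by exact_mod_cast h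
      simp only [Finset.sum_const, Finset.card_range, nsmul_eq_mul, mul_one] at h1
      linarith [(Nat.cast_nonneg τ : (0 : ℝ) ≤ τ)]
    -- Peeling off the first block: it contributes at most `τ`, and the rest is a quarter of a
    -- shorter sum, so `τ + 2τ/4 ≤ 2τ`.
    · obtain ⟨m, rfl⟩ := Nat.exists_eq_add_of_le h
      rw [Finset.sum_range_add]
      have h1 : ∑ k ∈ Finset.range τ, (1 / 4 : ℝ) ^ (k / τ) ≤ ∑ k ∈ Finset.range τ, (1 : ℝ) :=
        Finset.sum_le_sum fun k _ => pow_le_one₀ (by norm_num) (by norm_num)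
      have h2 : ∑ k ∈ Finset.range m, (1 / 4 : ℝ) ^ ((τ + k) / τ)
          = 1 / 4 * ∑ k ∈ Finset.range m, (1 / 4 : ℝ) ^ (k / τ) := by
        rw [Finset.mul_sum]
        refine Finset.sum_congr rfl fun k _ => ?_
        rw [Nat.add_div_left _ hτ, pow_succ']
      have h3 := ih m (by omega)
      simp only [Finset.sum_const, Finset.card_range, nsmul_eq_mul, mul_one] at h1
      rw [h2]
      linarith [(Nat.cast_nonneg τ : (0 : ℝ) ≤ τ)]

theorem sum_Icc_geometric_div_le {τ : ℕ} (hτ : 0 < τ) (n : ℕ) :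
    ∑ k ∈ Finset.Icc 1 n, (1 / 4 : ℝ) ^ (k / τ) ≤ 2 * τ :=
  (Finset.sum_le_sum_of_subset_of_nonneg (fun k hk => by
    rw [Finset.mem_Icc] at hk; rw [Finset.mem_range]; omega)
    fun _ _ _ => by positivity).trans (sum_range_geometric_div_le hτ (n + 1))

/-- With truncated subtraction the exponent is `|i - j| / τ`; on each side of `i` the distance is
injective in `j`, which costs one geometric sum per side. -/
theorem sum_Icc_geometric_dist_le {τ : ℕ} (hτ : 0 < τ) (n i : ℕ) :
    ∑ j ∈ Finset.Icc 1 n, (1 / 4 : ℝ) ^ ((i - j + (j - i)) / τ) ≤ 4 * τ := by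
  have key : ∀ (s : Finset ℕ) (φ : ℕ → ℕ), Set.InjOn φ s → (∀ j ∈ s, φ j ≤ n + i) →
      ∑ j ∈ s, (1 / 4 : ℝ) ^ (φ j / τ) ≤ 2 * τ := by
    intro s φ hφ hs
    rw [← Finset.sum_image (f := fun k => (1 / 4 : ℝ) ^ (k / τ)) hφ]
    refine (Finset.sum_le_sum_of_subset_of_nonneg (fun k hk => ?_)
      fun _ _ _ => by positivity).trans (sum_range_geometric_div_le hτ (n + i + 1))
    obtain ⟨j, hj, rfl⟩ := Finset.mem_image.1 hk
    rw [Finset.mem_range]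
    exact Nat.lt_succ_of_le (hs j hj)
  rw [← Finset.sum_filter_add_sum_filter_not _ (fun j => j ≤ i)]
  have h1 := key ((Finset.Icc 1 n).filter (fun j => j ≤ i)) (fun j => i - j + (j - i))
    (fun j hj k hk h => by simp at hj hk h; omega) (fun j hj => by simp at hj; omega)
  have h2 := key ((Finset.Icc 1 n).filter (fun j => ¬ j ≤ i)) (fun j => i - j + (j - i))
    (fun j hj k hk h => by simp at hj hk h; omega) (fun j hj => by simp at hj; omega)
  linarith

end GeometricSum

/-! ### Bias and second moment of averages of Markovian noise -/

section Noise

variable {E : Type*} [NormedAddCommGroup E] [InnerProductSpace ℝ E] [MeasurableSpace E]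
  {Z : Type*} [MeasurableSpace Z]

/-- A noise field `H`, determined by the path up to time `T`, centred with respect to `π` and
bounded by the path-dependent scale `s`. -/
structure IsNoise (π : Measure Z) (T : ℕ) (H : (ℕ → Z) → Z → E) (s : (ℕ → Z) → ℝ) (K : ℝ) :
    Prop where
  measurable : Measurable (Function.uncurry H)
  measurable_scale : Measurable s
  determined : DeterminedBy T H
  norm_le : ∀ p z, ‖H p z‖ ≤ s p
  scale_le : ∀ p, s p ≤ K
  mean_zero : ∀ p, ∫ z, H p z ∂π = 0

/-- The average of the noise over the `n` samples following time `T`. -/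
noncomputable def noiseMean (H : (ℕ → Z) → Z → E) (T n : ℕ) (p : ℕ → Z) : E :=
  (n : ℝ)⁻¹ • ∑ i ∈ Finset.Icc 1 n, H p (p (T + i))

variable {π : Measure Z} {T : ℕ} {H : (ℕ → Z) → Z → E}
  {s : (ℕ → Z) → ℝ} {K : ℝ}

theorem IsNoise.measurable_sample (hH : IsNoise π T H s K) (i : ℕ) :
    Measurable fun p : ℕ → Z => H p (p i) :=
  hH.measurable.comp (measurable_id.prodMk (measurable_pi_apply i))

theorem IsNoise.scale_nonneg (hH : IsNoise π T H s K) (p : ℕ → Z) : 0 ≤ s p :=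
  (norm_nonneg _).trans (hH.norm_le p (p 0))

theorem IsNoise.norm_noiseMean_le (hH : IsNoise π T H s K) (n : ℕ) (p : ℕ → Z) :
    ‖noiseMean H T n p‖ ≤ s p := by
  rcases Nat.eq_zero_or_pos n with rfl | hn
  · simpa [noiseMean] using hH.scale_nonneg p
  · have hn' : (0 : ℝ) < n := by exact_mod_cast hn
    rw [noiseMean, norm_smul, norm_inv, Real.norm_natCast, inv_mul_le_iff₀ hn']
    refine (norm_sum_le_of_le _ fun i _ => hH.norm_le p (p (T + i))).trans ?_
    simp

variable [ProperSpace E] [BorelSpace E]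

theorem IsNoise.measurable_noiseMean (hH : IsNoise π T H s K) (n : ℕ) :
    Measurable (noiseMean H T n) :=
  (Finset.measurable_sum _ fun i _ => hH.measurable_sample (T + i)).const_smul _

variable [IsProbabilityMeasure π] {Q : Kernel Z Z} [IsMarkovKernel Q]
  {Ω : Type*} [MeasurableSpace Ω] {P : Measure Ω} [IsProbabilityMeasure P] {ζ : ℕ → Ω → Z} {τ : ℕ}

/-- Decorrelation applied to the scalar `⟪w p, H p z⟫`, which is centred in `z` because `w p` is
fixed. The uniform bounds `K` and `Kw` only secure integrability and do not enter the estimate. -/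
theorem IsNoise.abs_integral_inner_le (hH : IsNoise π T H s K) (hζ : IsMarkovChain P Q ζ)
    (hQ : UniformlyErgodic Q τ) (hπ : Kernel.Invariant Q π) {n : ℕ} (hn : T ≤ n) (k : ℕ)
    {w : (ℕ → Z) → E} (hw : Measurable w) (hwn : DeterminedBy n w) {Kw : ℝ}
    (hwK : ∀ p, ‖w p‖ ≤ Kw) :
    |∫ ω, inner ℝ (w fun i => ζ i ω) (H (fun i => ζ i ω) (ζ (n + k) ω)) ∂P| ≤
      2 * (1 / 4) ^ (k / τ) * ∫ ω, ‖w fun i => ζ i ω‖ * s (fun i => ζ i ω) ∂P := by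
  refine hζ.abs_integral_le hQ hπ (f := fun p z => inner ℝ (w p) (H p z))
    (s := fun p => ‖w p‖ * s p) (K := Kw * K) k ?_ ?_ ?_ ?_ ?_ ?_
  · exact (hw.comp measurable_fst).inner hH.measurable
  · exact hw.norm.mul hH.measurable_scale
  · intro p
    funext z
    simp only
    rw [hwn p, hH.determined.mono hn p]
  · exact fun p z => (abs_real_inner_le_norm _ _).trans
      (mul_le_mul_of_nonneg_left (hH.norm_le p z) (norm_nonneg _))
  · exact fun p => mul_le_mul (hwK p) (hH.scale_le p) (hH.scale_nonneg p)
      ((norm_nonneg _).trans (hwK p))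
  · intro p
    have hi : Integrable (H p) π := Integrable.of_bound
      (hH.measurable.comp measurable_prodMk_left).aestronglyMeasurable (s p)
      (Filter.Eventually.of_forall (hH.norm_le p))
    rw [integral_inner hi, hH.mean_zero, inner_zero_right]

theorem IsNoise.abs_integral_inner_noiseMean_le (hH : IsNoise π T H s K)
    (hζ : IsMarkovChain P Q ζ) (hQ : UniformlyErgodic Q τ) (hπ : Kernel.Invariant Q π) (n : ℕ)
    {w : (ℕ → Z) → E} (hw : Measurable w) (hwn : DeterminedBy T w) {Kw : ℝ}
    (hwK : ∀ p, ‖w p‖ ≤ Kw) :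
    |∫ ω, inner ℝ (w fun i => ζ i ω) (noiseMean H T n fun i => ζ i ω) ∂P| ≤
      4 * τ / n * ∫ ω, ‖w fun i => ζ i ω‖ * s (fun i => ζ i ω) ∂P := by
  set I := ∫ ω, ‖w fun i => ζ i ω‖ * s (fun i => ζ i ω) ∂P with hI
  have hI0 : 0 ≤ I := integral_nonneg fun ω => mul_nonneg (norm_nonneg _) (hH.scale_nonneg _)
  have hint : ∀ i, Integrable (fun ω => inner ℝ (w fun i => ζ i ω)
      (H (fun i => ζ i ω) (ζ (T + i) ω))) P := fun i =>
    integrable_of_abs_le ((hw.inner (hH.measurable_sample (T + i))).comp hζ.measurable_path)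
      (s := Kw * K) fun ω => (abs_real_inner_le_norm _ _).trans
        (mul_le_mul (hwK _) ((hH.norm_le _ _).trans (hH.scale_le _)) (norm_nonneg _)
          ((norm_nonneg _).trans (hwK fun i => ζ i ω)))
  simp only [noiseMean, inner_smul_right, inner_sum]
  rw [integral_const_mul, integral_finsetSum _ fun i _ => hint i, abs_mul,
    abs_of_nonneg (by positivity)]
  have h1 : |∑ i ∈ Finset.Icc 1 n, ∫ ω, inner ℝ (w fun i => ζ i ω)
      (H (fun i => ζ i ω) (ζ (T + i) ω)) ∂P| ≤ 4 * τ * I := by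
    refine (Finset.abs_sum_le_sum_abs _ _).trans ((Finset.sum_le_sum fun i _ =>
      hH.abs_integral_inner_le hζ hQ hπ le_rfl i hw hwn hwK).trans ?_)
    rw [← Finset.sum_mul, ← Finset.mul_sum]
    have := sum_Icc_geometric_div_le hQ.1 n
    exact mul_le_mul_of_nonneg_right (by linarith) hI0
  calc (n : ℝ)⁻¹ * _ ≤ (n : ℝ)⁻¹ * (4 * τ * I) := by gcongr
    _ = _ := by ring

/-- Expanding the square gives `n²` covariances; the one at distance `|i - j|` decays geometrically,
so each row sums to `O(τ)` and the total is `O(nτ)`. -/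
theorem IsNoise.integral_norm_noiseMean_sq_le (hH : IsNoise π T H s K)
    (hζ : IsMarkovChain P Q ζ) (hQ : UniformlyErgodic Q τ) (hπ : Kernel.Invariant Q π) (n : ℕ) :
    ∫ ω, ‖noiseMean H T n fun i => ζ i ω‖ ^ 2 ∂P ≤
      8 * τ / n * ∫ ω, s (fun i => ζ i ω) ^ 2 ∂P := by
  set I := ∫ ω, s (fun i => ζ i ω) ^ 2 ∂P with hI
  have hI0 : 0 ≤ I := integral_nonneg fun ω => sq_nonneg _
  have hsi : Integrable (fun ω => s (fun i => ζ i ω) ^ 2) P :=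
    integrable_of_abs_le ((hH.measurable_scale.pow_const 2).comp hζ.measurable_path)
      (s := K ^ 2) fun ω => by
        rw [abs_of_nonneg (sq_nonneg _)]
        exact pow_le_pow_left₀ (hH.scale_nonneg _) (hH.scale_le _) 2
  set c : ℕ → ℕ → Ω → ℝ := fun i j ω => inner ℝ (H (fun i => ζ i ω) (ζ (T + i) ω))
      (H (fun i => ζ i ω) (ζ (T + j) ω)) with hc
  have hcb : ∀ i j ω, |c i j ω| ≤ s (fun i => ζ i ω) ^ 2 := fun i j ω => by
    rw [sq]
    exact (abs_real_inner_le_norm _ _).trans (mul_le_mul (hH.norm_le _ _) (hH.norm_le _ _)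
      (norm_nonneg _) (hH.scale_nonneg _))
  have hint : ∀ i j, Integrable (c i j) P := fun i j =>
    hsi.mono' (((hH.measurable_sample (T + i)).inner (hH.measurable_sample (T + j))).comp
      hζ.measurable_path).aestronglyMeasurable (Filter.Eventually.of_forall (hcb i j))
  have hlt : ∀ i j, i < j → |∫ ω, c i j ω ∂P| ≤ 2 * (1 / 4) ^ ((j - i) / τ) * I := by
    intro i j hij
    -- The earlier noise vector plays the role of the past, now up to time `T + i`.
    have h1 := hH.abs_integral_inner_le hζ hQ hπ (n := T + i) (by omega) (j - i)
      (w := fun p => H p (p (T + i))) (hH.measurable_sample _) (fun p => by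
        have h2 := hH.determined.mono (show T ≤ T + i by omega) p
        have h3 := determinedBy_apply (Z := Z) (le_refl (T + i)) p
        simp only at h3 ⊢
        rw [h2, h3]) (fun p => (hH.norm_le _ _).trans (hH.scale_le p))
    rw [show T + i + (j - i) = T + j by omega] at h1
    refine h1.trans (mul_le_mul_of_nonneg_left ?_ (by positivity))
    refine integral_mono_of_nonneg (Filter.Eventually.of_forall fun ω =>
      mul_nonneg (norm_nonneg _) (hH.scale_nonneg _)) hsi (Filter.Eventually.of_forall fun ω => ?_)
    simp only
    rw [sq]
    exact mul_le_mul_of_nonneg_right (hH.norm_le _ _) (hH.scale_nonneg _)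
  have hall : ∀ i j, ∫ ω, c i j ω ∂P ≤ 2 * (1 / 4) ^ ((i - j + (j - i)) / τ) * I := by
    intro i j
    rcases lt_trichotomy i j with h | h | h
    · rw [Nat.sub_eq_zero_of_le h.le, zero_add]
      exact (le_abs_self _).trans (hlt i j h)
    · subst h
      have h1 : ∫ ω, c i i ω ∂P ≤ I :=
        integral_mono (hint i i) hsi fun ω => (le_abs_self _).trans (hcb i i ω)
      simp
      linarith
    · rw [Nat.sub_eq_zero_of_le h.le, add_zero]
      refine (le_abs_self _).trans (le_trans (le_of_eq ?_) (hlt j i h))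
      simp only [hc]
      congr 2
      funext ω
      exact real_inner_comm _ _
  have hexp : ∀ ω, ‖noiseMean H T n fun i => ζ i ω‖ ^ 2 = ((n : ℝ)⁻¹) ^ 2 *
      ∑ i ∈ Finset.Icc 1 n, ∑ j ∈ Finset.Icc 1 n, c i j ω := by
    intro ω
    rw [noiseMean, norm_smul, mul_pow, ← real_inner_self_eq_norm_sq (∑ i ∈ _, _),
      sum_inner]
    simp only [inner_sum, hc, norm_inv, Real.norm_natCast]
  simp only [hexp]
  rw [integral_const_mul,
    integral_finsetSum _ fun i _ => integrable_finsetSum _ fun j _ => hint i j]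
  have h1 : ∑ i ∈ Finset.Icc 1 n, ∫ ω, ∑ j ∈ Finset.Icc 1 n, c i j ω ∂P ≤ n * (8 * τ * I) := by
    have h2 : ∀ i ∈ Finset.Icc 1 n, ∫ ω, ∑ j ∈ Finset.Icc 1 n, c i j ω ∂P ≤ 8 * τ * I := by
      intro i _
      rw [integral_finsetSum _ fun j _ => hint i j]
      refine (Finset.sum_le_sum fun j _ => hall i j).trans ?_
      rw [← Finset.sum_mul, ← Finset.mul_sum]
      have := sum_Icc_geometric_dist_le hQ.1 n i
      exact mul_le_mul_of_nonneg_right (by linarith) hI0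
    refine (Finset.sum_le_sum h2).trans ?_
    simp
  refine (mul_le_mul_of_nonneg_left h1 (by positivity)).trans (le_of_eq ?_)
  rcases Nat.eq_zero_or_pos n with rfl | hn
  · simp
  · have hn' : (n : ℝ) ≠ 0 := by exact_mod_cast hn.ne'
    field_simp

end Noise

/-! ### The truncated geometric level -/

section Level

/-- The largest level `j` with `2 ^ j ≤ M`. -/
noncomputable def topLevel (M : ℝ) : ℕ := Nat.log 2 ⌊M⌋₊

theorem two_pow_le_iff_le_topLevel {M : ℝ} (hM : 2 ≤ M) (j : ℕ) :
    (2 : ℝ) ^ j ≤ M ↔ j ≤ topLevel M := by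
  have h2 : 2 ≤ ⌊M⌋₊ := Nat.le_floor (by exact_mod_cast hM)
  rw [topLevel, Nat.le_log_iff_pow_le (by norm_num) (by omega), Nat.le_floor_iff (by linarith)]
  push_cast
  rfl

theorem lt_two_pow_topLevel_succ {M : ℝ} (hM : 2 ≤ M) : M < 2 * 2 ^ topLevel M := by
  by_contra! h
  rw [← pow_succ', two_pow_le_iff_le_topLevel hM] at h
  omega

theorem topLevel_le_logb {M : ℝ} (hM : 2 ≤ M) : (topLevel M : ℝ) ≤ Real.logb 2 M := by
  rw [Real.le_logb_iff_rpow_le (by norm_num) (by linarith), Real.rpow_natCast,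
    two_pow_le_iff_le_topLevel hM]

variable {ν : Measure ℕ} [IsProbabilityMeasure ν]

theorem integrable_nat_of_abs_le {f : ℕ → ℝ} {s : ℝ} (hs : ∀ j, |f j| ≤ s) : Integrable f ν :=
  integrable_of_abs_le (measurable_of_countable f) hs

theorem integral_const_add_sum_ite (hν : ∀ i, 1 ≤ i → ν {i} = (1 / 2) ^ i) (m : ℕ) (c0 : ℝ)
    (c : ℕ → ℝ) :
    Integrable (fun j => c0 + ∑ i ∈ Finset.Icc 1 m, if j = i then c i else 0) ν ∧
    ∫ j, (c0 + ∑ i ∈ Finset.Icc 1 m, if j = i then c i else 0) ∂ν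
      = c0 + ∑ i ∈ Finset.Icc 1 m, (1 / 2) ^ i * c i := by
  have e : ∀ i, (fun j => if j = i then c i else 0) = ({i} : Set ℕ).indicator fun _ => c i := by
    intro i
    funext j
    simp [Set.indicator_apply]
  have hi : ∀ i, Integrable (fun j => if j = i then c i else 0) ν := fun i => by
    rw [e]
    exact (integrable_const _).indicator (measurableSet_singleton i)
  refine ⟨(integrable_const _).add (integrable_finsetSum _ fun i _ => hi i), ?_⟩
  rw [integral_add (integrable_const _) (integrable_finsetSum _ fun i _ => hi i),
    integral_finsetSum _ fun i _ => hi i]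
  congr 1
  · simp
  · refine Finset.sum_congr rfl fun i h => ?_
    rw [e, integral_indicator (measurableSet_singleton i), integral_const, smul_eq_mul,
      measureReal_restrict_apply_univ, measureReal_def, hν i (Finset.mem_Icc.1 h).1]
    simp

end Level

/-! ### Bias and second moment of the randomized estimator -/

section LevelNoise

variable {E : Type*} [NormedAddCommGroup E] [InnerProductSpace ℝ E] [MeasurableSpace E]
  {Z : Type*} [MeasurableSpace Z]

/-- The noise of the randomized estimator at level `j`. -/
noncomputable def levelNoise (H : (ℕ → Z) → Z → E) (M : ℝ) (B T j : ℕ) (p : ℕ → Z) : E :=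
  noiseMean H T B p + if (2 : ℝ) ^ j ≤ M then
    (2 : ℝ) ^ j • (noiseMean H T (2 ^ j * B) p - noiseMean H T (2 ^ (j - 1) * B) p) else 0

omit [MeasurableSpace E] [MeasurableSpace Z] in
theorem levelNoise_eq_sum {M : ℝ} (hM : 2 ≤ M) (H : (ℕ → Z) → Z → E) (B T j : ℕ) (p : ℕ → Z) :
    levelNoise H M B T j p = noiseMean H T B p + ∑ i ∈ Finset.Icc 1 (topLevel M),
      if j = i then (2 : ℝ) ^ i •
        (noiseMean H T (2 ^ i * B) p - noiseMean H T (2 ^ (i - 1) * B) p) else 0 := by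
  rw [levelNoise, Finset.sum_ite_eq]
  congr 1
  simp only [two_pow_le_iff_le_topLevel hM, Finset.mem_Icc]
  -- At `j = 0` truncation gives `j - 1 = 0`, so the correction is a difference of equal averages
  -- and vanishes, in agreement with the empty term of the sum.
  rcases Nat.eq_zero_or_pos j with rfl | hj
  · simp
  · simp [show 1 ≤ j from hj]

omit [MeasurableSpace E] [MeasurableSpace Z] in
theorem sum_noiseMean_sub (H : (ℕ → Z) → Z → E) (B T m : ℕ) (p : ℕ → Z) :
    noiseMean H T B p + ∑ i ∈ Finset.Icc 1 m,
      (noiseMean H T (2 ^ i * B) p - noiseMean H T (2 ^ (i - 1) * B) p)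
      = noiseMean H T (2 ^ m * B) p := by
  induction m with
  | zero => simp
  | succ m ih =>
    rw [Finset.sum_Icc_succ_top (by omega), ← add_assoc, ih]
    simp

variable {π : Measure Z} {T : ℕ} {H : (ℕ → Z) → Z → E} {s : (ℕ → Z) → ℝ} {K : ℝ}

theorem IsNoise.norm_levelNoise_le (hH : IsNoise π T H s K) {M : ℝ} (hM : 2 ≤ M) (B j : ℕ)
    (p : ℕ → Z) : ‖levelNoise H M B T j p‖ ≤ (1 + 2 * M) * s p := by
  have h0 := hH.scale_nonneg p
  rw [levelNoise, add_mul, one_mul]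
  refine (norm_add_le _ _).trans (add_le_add (hH.norm_noiseMean_le B p) ?_)
  split_ifs with h
  · rw [norm_smul, norm_pow, Real.norm_ofNat]
    have h1 := (norm_sub_le _ _).trans (add_le_add (hH.norm_noiseMean_le (2 ^ j * B) p)
      (hH.norm_noiseMean_le (2 ^ (j - 1) * B) p))
    calc _ ≤ M * (s p + s p) := by gcongr
      _ = _ := by ring
  · rw [norm_zero]
    positivity

variable [ProperSpace E] [BorelSpace E]

theorem IsNoise.measurable_levelNoise (hH : IsNoise π T H s K) (M : ℝ) (B j : ℕ) :
    Measurable (levelNoise H M B T j) := by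
  refine (hH.measurable_noiseMean B).add ?_
  split_ifs
  · exact ((hH.measurable_noiseMean _).sub (hH.measurable_noiseMean _)).const_smul _
  · exact measurable_const

variable [IsProbabilityMeasure π] {Q : Kernel Z Z} [IsMarkovKernel Q]
  {Ω : Type*} [MeasurableSpace Ω] {P : Measure Ω} [IsProbabilityMeasure P] {ζ : ℕ → Ω → Z} {τ : ℕ}
  {ν : Measure ℕ} [IsProbabilityMeasure ν]

/-- The probability `2^{-i}` cancels the factor `2^i`, so the mean over the level telescopes to a
single average over `2 ^ topLevel M * B` samples, more than `M * B / 2`. -/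
theorem IsNoise.abs_integral_inner_levelNoise_le (hH : IsNoise π T H s K)
    (hζ : IsMarkovChain P Q ζ) (hQ : UniformlyErgodic Q τ) (hπ : Kernel.Invariant Q π)
    (hν : ∀ i, 1 ≤ i → ν {i} = (1 / 2) ^ i) {M : ℝ} (hM : 2 ≤ M) {B : ℕ} (hB : 1 ≤ B)
    {w : (ℕ → Z) → E} (hw : Measurable w) (hwn : DeterminedBy T w) {Kw : ℝ}
    (hwK : ∀ p, ‖w p‖ ≤ Kw) :
    |∫ j, ∫ ω, inner ℝ (w fun i => ζ i ω) (levelNoise H M B T j fun i => ζ i ω) ∂P ∂ν| ≤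
      8 * τ / (M * B) * ∫ ω, ‖w fun i => ζ i ω‖ * s (fun i => ζ i ω) ∂P := by
  have hint : ∀ n, Integrable (fun ω => inner ℝ (w fun i => ζ i ω)
      (noiseMean H T n fun i => ζ i ω)) P := fun n =>
    integrable_of_abs_le ((hw.inner (hH.measurable_noiseMean n)).comp hζ.measurable_path)
      (s := Kw * K) fun ω => (abs_real_inner_le_norm _ _).trans
        (mul_le_mul (hwK _) ((hH.norm_noiseMean_le _ _).trans (hH.scale_le _)) (norm_nonneg _)
          ((norm_nonneg _).trans (hwK fun i => ζ i ω)))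
  have hsub : ∀ n m, Integrable (fun ω => inner ℝ (w fun i => ζ i ω)
      (noiseMean H T n fun i => ζ i ω) - inner ℝ (w fun i => ζ i ω)
      (noiseMean H T m fun i => ζ i ω)) P := fun n m => (hint n).sub (hint m)
  set e : ℕ → ℝ := fun n => ∫ ω, inner ℝ (w fun i => ζ i ω)
      (noiseMean H T n fun i => ζ i ω) ∂P with he
  have h1 : ∀ j, ∫ ω, inner ℝ (w fun i => ζ i ω) (levelNoise H M B T j fun i => ζ i ω) ∂P
      = e B + ∑ i ∈ Finset.Icc 1 (topLevel M), if j = i then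
        2 ^ i * (e (2 ^ i * B) - e (2 ^ (i - 1) * B)) else 0 := by
    intro j
    rw [Finset.sum_ite_eq]
    simp only [levelNoise_eq_sum hM, Finset.sum_ite_eq, inner_add_right]
    split_ifs with hj
    · simp only [inner_smul_right, inner_sub_right]
      rw [integral_add (hint _) ((hsub _ _).const_mul _), integral_const_mul,
        integral_sub (hint _) (hint _)]
    · simp [he]
  simp only [h1]
  rw [(integral_const_add_sum_ite hν _ _ _).2]
  have h2 : e B + ∑ i ∈ Finset.Icc 1 (topLevel M),
      (1 / 2) ^ i * (2 ^ i * (e (2 ^ i * B) - e (2 ^ (i - 1) * B))) = e (2 ^ topLevel M * B) := by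
    have h3 : ∀ i, (1 / 2 : ℝ) ^ i * (2 ^ i * (e (2 ^ i * B) - e (2 ^ (i - 1) * B)))
        = e (2 ^ i * B) - e (2 ^ (i - 1) * B) := fun i => by
      rw [← mul_assoc, ← mul_pow]; norm_num
    simp only [h3]
    simp only [he, ← sum_noiseMean_sub H B T (topLevel M), inner_add_right, inner_sum,
      inner_sub_right]
    symm
    rw [integral_add (hint _) (integrable_finsetSum _ fun i _ => hsub _ _),
      integral_finsetSum _ fun i _ => hsub _ _]
    congr 1
    exact Finset.sum_congr rfl fun i _ => integral_sub (hint _) (hint _)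
  rw [h2]
  refine (hH.abs_integral_inner_noiseMean_le hζ hQ hπ _ hw hwn hwK).trans
    (mul_le_mul_of_nonneg_right ?_
      (integral_nonneg fun ω => mul_nonneg (norm_nonneg _) (hH.scale_nonneg _)))
  have hB' : (0 : ℝ) < B := by exact_mod_cast hB
  have h4 := lt_two_pow_topLevel_succ hM
  push_cast
  rw [div_le_div_iff₀ (by positivity) (by positivity)]
  have h5 : (0 : ℝ) ≤ 4 * τ * B := by positivity
  nlinarith [mul_le_mul_of_nonneg_left h4.le h5]

/-- The correction at level `i` has second moment `4^i · O(τ / (2^i B))` and probability `2^{-i}`,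
hence contributes `O(τ / B)` whatever `i` is. The price is the number of levels, only logarithmic in
`M`. -/
theorem IsNoise.integral_norm_levelNoise_sq_le (hH : IsNoise π T H s K)
    (hζ : IsMarkovChain P Q ζ) (hQ : UniformlyErgodic Q τ) (hπ : Kernel.Invariant Q π)
    (hν : ∀ i, 1 ≤ i → ν {i} = (1 / 2) ^ i) {M : ℝ} (hM : 2 ≤ M) {B : ℕ} (hB : 1 ≤ B) :
    ∫ j, ∫ ω, ‖levelNoise H M B T j fun i => ζ i ω‖ ^ 2 ∂P ∂ν ≤
      (16 + 96 * topLevel M) * (τ / B) * ∫ ω, s (fun i => ζ i ω) ^ 2 ∂P := by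
  set I := ∫ ω, s (fun i => ζ i ω) ^ 2 ∂P with hI
  have hI0 : 0 ≤ I := integral_nonneg fun ω => sq_nonneg _
  have hB' : (0 : ℝ) < B := by exact_mod_cast hB
  have hint : ∀ n, Integrable (fun ω => ‖noiseMean H T n fun i => ζ i ω‖ ^ 2) P := fun n =>
    integrable_of_abs_le (((hH.measurable_noiseMean n).norm.pow_const 2).comp hζ.measurable_path)
      (s := K ^ 2) fun ω => by
        rw [abs_of_nonneg (sq_nonneg _)]
        exact pow_le_pow_left₀ (norm_nonneg _)
          ((hH.norm_noiseMean_le _ _).trans (hH.scale_le _)) 2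
  have hadd : ∀ n m, Integrable (fun ω => ‖noiseMean H T n fun i => ζ i ω‖ ^ 2
      + ‖noiseMean H T m fun i => ζ i ω‖ ^ 2) P := fun n m => (hint n).add (hint m)
  have hv := fun n => hH.integral_norm_noiseMean_sq_le hζ hQ hπ n
  have h1 : ∀ j, ∫ ω, ‖levelNoise H M B T j fun i => ζ i ω‖ ^ 2 ∂P
      ≤ 16 * (τ / B) * I + ∑ i ∈ Finset.Icc 1 (topLevel M), if j = i then
        2 ^ i * (96 * (τ / B) * I) else 0 := by
    intro j
    rw [Finset.sum_ite_eq]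
    simp only [levelNoise_eq_sum hM, Finset.sum_ite_eq]
    have hvB := hv B
    rw [mul_div_assoc] at hvB
    split_ifs with hj
    · obtain ⟨i, rfl⟩ : ∃ i, j = i + 1 := ⟨j - 1, by rw [Finset.mem_Icc] at hj; omega⟩
      have h2 : ∀ ω, ‖noiseMean H T B (fun i => ζ i ω) + (2 : ℝ) ^ (i + 1) •
          (noiseMean H T (2 ^ (i + 1) * B) (fun i => ζ i ω)
            - noiseMean H T (2 ^ (i + 1 - 1) * B) fun i => ζ i ω)‖ ^ 2
          ≤ 2 * ‖noiseMean H T B fun i => ζ i ω‖ ^ 2 + 4 * 4 ^ (i + 1) *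
            (‖noiseMean H T (2 ^ (i + 1) * B) fun i => ζ i ω‖ ^ 2
            + ‖noiseMean H T (2 ^ i * B) fun i => ζ i ω‖ ^ 2) := by
        intro ω
        have b1 := pow_le_pow_left₀ (norm_nonneg _) (norm_add_le (noiseMean H T B fun i => ζ i ω)
          ((2 : ℝ) ^ (i + 1) • (noiseMean H T (2 ^ (i + 1) * B) (fun i => ζ i ω)
            - noiseMean H T (2 ^ i * B) fun i => ζ i ω))) 2
        have b2 := pow_le_pow_left₀ (norm_nonneg _) (norm_sub_le
          (noiseMean H T (2 ^ (i + 1) * B) fun i => ζ i ω)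
          (noiseMean H T (2 ^ i * B) fun i => ζ i ω)) 2
        have b3 := add_sq_le (a := ‖noiseMean H T B fun i => ζ i ω‖)
          (b := ‖(2 : ℝ) ^ (i + 1) • (noiseMean H T (2 ^ (i + 1) * B) (fun i => ζ i ω)
            - noiseMean H T (2 ^ i * B) fun i => ζ i ω)‖)
        have b4 := add_sq_le (a := ‖noiseMean H T (2 ^ (i + 1) * B) fun i => ζ i ω‖)
          (b := ‖noiseMean H T (2 ^ i * B) fun i => ζ i ω‖)
        have b5 : ‖(2 : ℝ) ^ (i + 1) • (noiseMean H T (2 ^ (i + 1) * B) (fun i => ζ i ω)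
            - noiseMean H T (2 ^ i * B) fun i => ζ i ω)‖ ^ 2 = 4 ^ (i + 1) *
            ‖noiseMean H T (2 ^ (i + 1) * B) (fun i => ζ i ω)
            - noiseMean H T (2 ^ i * B) fun i => ζ i ω‖ ^ 2 := by
          rw [norm_smul, norm_pow, Real.norm_ofNat, mul_pow, ← pow_mul, mul_comm (i + 1) 2,
            pow_mul]
          norm_num
        rw [b5] at b3
        have b6 := mul_le_mul_of_nonneg_left (b2.trans b4)
          (by positivity : (0 : ℝ) ≤ 4 ^ (i + 1))
        simp only [Nat.add_sub_cancel]
        nlinarith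
      refine (integral_mono_of_nonneg (Filter.Eventually.of_forall fun ω => sq_nonneg _)
        (((hint _).const_mul _).add ((hadd _ _).const_mul _))
        (Filter.Eventually.of_forall h2)).trans ?_
      simp only [Pi.add_apply]
      rw [integral_add ((hint _).const_mul _) ((hadd _ _).const_mul _),
        integral_const_mul, integral_const_mul, integral_add (hint _) (hint _)]
      have c1 := hv (2 ^ (i + 1) * B)
      have c2 := hv (2 ^ i * B)
      have e1 : (8 : ℝ) * τ / ((2 ^ (i + 1) * B : ℕ) : ℝ) * I
          = 8 * (τ / B) * I / 2 ^ (i + 1) := by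
        push_cast; field_simp
      have e2 : (8 : ℝ) * τ / ((2 ^ i * B : ℕ) : ℝ) * I
          = 16 * (τ / B) * I / 2 ^ (i + 1) := by
        push_cast; field_simp; ring
      rw [e1] at c1
      rw [e2] at c2
      have c3 := mul_le_mul_of_nonneg_left (add_le_add c1 c2)
        (by positivity : (0 : ℝ) ≤ 4 * 4 ^ (i + 1))
      -- Here `96 = 4 * (8 + 16)`, where `8` and `16` come from the averages over `2 ^ (i + 1) * B`
      -- and `2 ^ i * B` samples.
      have e3 : (4 : ℝ) * 4 ^ (i + 1) * (8 * (τ / B) * I / 2 ^ (i + 1)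
          + 16 * (τ / B) * I / 2 ^ (i + 1)) = 2 ^ (i + 1) * (96 * (τ / B) * I) := by
        have : (4 : ℝ) ^ (i + 1) = 2 ^ (i + 1) * 2 ^ (i + 1) := by
          rw [← mul_pow]; norm_num
        rw [this]
        field_simp
        ring
      linarith
    · simp only [add_zero]
      have : 0 ≤ (τ / B : ℝ) * I := by positivity
      linarith
  have hmain := integral_const_add_sum_ite hν (topLevel M) (16 * (τ / B) * I)
    (fun i => 2 ^ i * (96 * (τ / B) * I))
  refine (integral_mono_of_nonneg (Filter.Eventually.of_forall fun j =>
    integral_nonneg fun ω => sq_nonneg _) hmain.1 (Filter.Eventually.of_forall h1)).trans ?_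
  rw [hmain.2]
  have h3 : ∀ i : ℕ, (1 / 2 : ℝ) ^ i * (2 ^ i * (96 * (τ / B) * I)) = 96 * (τ / B) * I :=
    fun i => by rw [← mul_assoc, ← mul_pow]; norm_num
  simp only [h3, Finset.sum_const, Nat.card_Icc, Nat.add_sub_cancel, nsmul_eq_mul]
  exact le_of_eq (by ring)

end LevelNoise

/-! ### The stochastic oracle as a noise field -/

section Oracle

variable {E : Type*} [NormedAddCommGroup E] [InnerProductSpace ℝ E] [MeasurableSpace E]
  {Z : Type*} [MeasurableSpace Z]

/-- The standing assumptions on the stochastic oracle `G` for `F`. -/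
structure IsOracle (X : Set E) (F : E → E) (xs : E) (σ Δ : ℝ) (π : Measure Z) (G : E → Z → E) :
    Prop where
  measurable : Measurable fun p : E × Z => G p.1 p.2
  mean : ∀ x ∈ X, ∫ z, G x z ∂π = F x
  bound : ∀ x ∈ X, ∀ z, ‖G x z - F x‖ ^ 2 ≤ σ ^ 2 + Δ ^ 2 * ‖x - xs‖ ^ 2

/-- The noise field of the oracle at a path-dependent point. -/
noncomputable def oracleNoise (π : Measure Z) (G : E → Z → E) (ξ : (ℕ → Z) → E) (p : ℕ → Z)
    (z : Z) : E := G (ξ p) z - ∫ y, G (ξ p) y ∂π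

/-- The bound on the noise at `x`. -/
noncomputable def noiseScale (xs : E) (σ Δ : ℝ) (x : E) : ℝ := √(σ ^ 2 + Δ ^ 2 * ‖x - xs‖ ^ 2)

omit [InnerProductSpace ℝ E] [MeasurableSpace E] in
theorem noiseScale_sq (xs : E) (σ Δ : ℝ) (x : E) :
    noiseScale xs σ Δ x ^ 2 = σ ^ 2 + Δ ^ 2 * ‖x - xs‖ ^ 2 := Real.sq_sqrt (by positivity)

/-- A measurable, bounded, `X`-valued point depending on the path up to time `T`. -/
structure IsAdaptedPoint (X : Set E) (xs : E) (T : ℕ) (R : ℝ) (ξ : (ℕ → Z) → E) : Prop where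
  measurable : Measurable ξ
  determined : DeterminedBy T ξ
  mem : ∀ p, ξ p ∈ X
  norm_le : ∀ p, ‖ξ p - xs‖ ≤ R

variable {X : Set E} {F : E → E} {xs : E} {σ Δ : ℝ} {π : Measure Z}
  {G : E → Z → E} {T : ℕ} {R : ℝ} {ξ : (ℕ → Z) → E}

theorem IsOracle.batchMean_sub (hG : IsOracle X F xs σ Δ π G) (hξ : ∀ p, ξ p ∈ X) {n : ℕ}
    (hn : 1 ≤ n) (p : ℕ → Z) :
    batchMean G (ξ p) p T n - F (ξ p) = noiseMean (oracleNoise π G ξ) T n p := by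
  have hn' : (n : ℝ) ≠ 0 := by exact_mod_cast (by omega : n ≠ 0)
  simp only [batchMean, noiseMean, oracleNoise, hG.mean _ (hξ p), Finset.sum_sub_distrib, smul_sub,
    Finset.sum_const, Nat.card_Icc, Nat.add_sub_cancel]
  rw [← Nat.cast_smul_eq_nsmul ℝ, smul_smul, inv_mul_cancel₀ hn', one_smul]

theorem IsOracle.levelEstimator_sub (hG : IsOracle X F xs σ Δ π G) (hξ : ∀ p, ξ p ∈ X) {B : ℕ}
    (hB : 1 ≤ B) (M : ℝ) (j : ℕ) (p : ℕ → Z) :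
    levelEstimator G M B (ξ p) p T j - F (ξ p) = levelNoise (oracleNoise π G ξ) M B T j p := by
  have h : ∀ i, 1 ≤ 2 ^ i * B := fun i => Nat.mul_pos (by positivity) hB
  rw [levelEstimator, levelNoise, ← hG.batchMean_sub hξ hB, ← hG.batchMean_sub hξ (h j),
    ← hG.batchMean_sub hξ (h (j - 1)), sub_sub_sub_cancel_right]
  abel

variable [IsProbabilityMeasure π] [ProperSpace E] [BorelSpace E]

/-- Centring `oracleNoise` by the `π`-mean instead of `F` lets joint measurability follow from that
of `G` alone; the two agree because the point stays in `X`. -/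
theorem IsOracle.isNoise (hG : IsOracle X F xs σ Δ π G) (hξ : IsAdaptedPoint X xs T R ξ) :
    IsNoise π T (oracleNoise π G ξ) (fun p => noiseScale xs σ Δ (ξ p))
      √(σ ^ 2 + Δ ^ 2 * R ^ 2) where
  measurable := by
    have h1 : Measurable fun q : (ℕ → Z) × Z => G (ξ q.1) q.2 :=
      hG.measurable.comp ((hξ.measurable.comp measurable_fst).prodMk measurable_snd)
    have h2 : Measurable fun p => ∫ y, G (ξ p) y ∂π :=
      (h1.stronglyMeasurable.integral_prod_right' (ν := π)).measurable
    exact h1.sub (h2.comp measurable_fst)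
  measurable_scale := by
    have := hξ.measurable
    unfold noiseScale
    fun_prop
  determined p := by
    funext z
    simp only [oracleNoise, hξ.determined p]
  norm_le p z := by
    rw [oracleNoise, hG.mean _ (hξ.mem p), noiseScale]
    exact Real.le_sqrt_of_sq_le (hG.bound _ (hξ.mem p) z)
  scale_le p := by
    have := hξ.norm_le p
    unfold noiseScale
    gcongr
  mean_zero p := by
    have hi : Integrable (fun z => G (ξ p) z - F (ξ p)) π := Integrable.of_bound
      ((hG.measurable.comp measurable_prodMk_left).sub measurable_const).aestronglyMeasurable
      (noiseScale xs σ Δ (ξ p)) (Filter.Eventually.of_forall fun z =>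
        Real.le_sqrt_of_sq_le (hG.bound _ (hξ.mem p) z))
    have hi' : Integrable (G (ξ p)) π := (hi.add (integrable_const (F (ξ p)))).congr
      (Filter.Eventually.of_forall fun z => by simp)
    simp only [oracleNoise]
    rw [integral_sub hi' (integrable_const _)]
    simp

end Oracle

/-! ### One iteration as a function of the path -/

section NextPoint

variable {E : Type*} [NormedAddCommGroup E] [InnerProductSpace ℝ E] {Z : Type*}

/-- The point `x^{k+1}` computed from `x = x^k`, the sample counter `T` and the level `j`. -/
noncomputable def nextPoint (X : Set E) (r : E → ℝ) (G : E → Z → E) (γ M : ℝ) (B : ℕ)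
    (z : ℕ → Z) (x : E) (T j : ℕ) : E :=
  prox X r γ (x - γ • levelEstimator G M B (extrapolate X r G γ B z x T) z (T + B) j)

theorem egState_succ (X : Set E) (r : E → ℝ) (G : E → Z → E) (γ M : ℝ) (B : ℕ) (x0 : E)
    (z : ℕ → Z) (j : ℕ → ℕ) (k : ℕ) :
    egState X r G γ M B x0 z j (k + 1) =
      (nextPoint X r G γ M B z (egState X r G γ M B x0 z j k).1
        (egState X r G γ M B x0 z j k).2 (j k),
      (egState X r G γ M B x0 z j k).2 + B + 2 ^ j k * B) := rfl

variable {G : E → Z → E}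

theorem determinedBy_batchMean {T B : ℕ} {ξ : (ℕ → Z) → E} (hξ : DeterminedBy T ξ) :
    DeterminedBy (T + B) fun p => batchMean G (ξ p) p T B := by
  intro p
  simp only [batchMean, hξ.mono (Nat.le_add_right T B) p]
  congr 1
  refine Finset.sum_congr rfl fun i hi => ?_
  exact congrArg _ (determinedBy_apply (by rw [Finset.mem_Icc] at hi; omega) p)

theorem determinedBy_levelEstimator {T B j n : ℕ} {M : ℝ} {ξ : (ℕ → Z) → E}
    (hξ : DeterminedBy T ξ) (hn : T + 2 ^ j * B ≤ n) :
    DeterminedBy n fun p => levelEstimator G M B (ξ p) p T j := by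
  intro p
  have h1 : ∀ i, i ≤ j → batchMean G (ξ (stopAt n p)) (stopAt n p) T (2 ^ i * B)
      = batchMean G (ξ p) p T (2 ^ i * B) := fun i hi => by
    refine (determinedBy_batchMean (G := G) (B := 2 ^ i * B) hξ).mono (le_trans ?_ hn) p
    gcongr
    norm_num
  have h0 := h1 0 (Nat.zero_le _)
  rw [pow_zero, one_mul] at h0
  simp only [levelEstimator, h0, h1 j le_rfl, h1 (j - 1) (by omega)]

end NextPoint

/-! ### Measurability of the iterates -/

section Measurability

variable {E : Type*} [NormedAddCommGroup E] [InnerProductSpace ℝ E] [MeasurableSpace E]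
  [ProperSpace E] [BorelSpace E] {Z : Type*} [MeasurableSpace Z] {G : E → Z → E}
  {Ω : Type*} [MeasurableSpace Ω]

theorem measurable_comp_countable {ι β : Type*} [Countable ι] [MeasurableSpace ι]
    [MeasurableSingletonClass ι] [MeasurableSpace β] {f : ι → Ω → β} (hf : ∀ i, Measurable (f i))
    {N : Ω → ι} (hN : Measurable N) : Measurable fun ω => f (N ω) ω :=
  (measurable_from_prod_countable_right (f := fun q : ι × Ω => f q.1 q.2) hf).comp
    (hN.prodMk measurable_id)

variable {x : Ω → E} {z : Ω → ℕ → Z}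

theorem measurable_batchMean (hG : Measurable fun p : E × Z => G p.1 p.2) (hx : Measurable x)
    (hz : Measurable z) (T n : ℕ) : Measurable fun ω => batchMean G (x ω) (z ω) T n :=
  (Finset.measurable_sum _ fun i _ =>
    hG.comp (hx.prodMk ((measurable_pi_apply (T + i)).comp hz))).const_smul _

theorem measurable_levelEstimator (hG : Measurable fun p : E × Z => G p.1 p.2) (hx : Measurable x)
    (hz : Measurable z) (M : ℝ) (B T j : ℕ) :
    Measurable fun ω => levelEstimator G M B (x ω) (z ω) T j := by
  refine (measurable_batchMean hG hx hz T B).add ?_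
  split_ifs
  · exact ((measurable_batchMean hG hx hz _ _).sub
      (measurable_batchMean hG hx hz _ _)).const_smul _
  · exact measurable_const

variable {X : Set E} {F : E → E} {r : E → ℝ} {xs : E} {γ μF μr L : ℝ}

theorem RegularVI.measurable_extrapolate (h : RegularVI X F r xs L μF μr) (hγ : 0 ≤ γ)
    (hG : Measurable fun p : E × Z => G p.1 p.2) (hx : Measurable x)
    (hz : Measurable z) (B T : ℕ) :
    Measurable fun ω => extrapolate X r G γ B (z ω) (x ω) T :=
  (h.continuous_prox hγ).measurable.comp
    (hx.sub ((measurable_batchMean hG hx hz T B).const_smul γ))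

theorem RegularVI.measurable_nextPoint (h : RegularVI X F r xs L μF μr) (hγ : 0 ≤ γ)
    (hG : Measurable fun p : E × Z => G p.1 p.2) (hx : Measurable x)
    (hz : Measurable z) (M : ℝ) (B T j : ℕ) :
    Measurable fun ω => nextPoint X r G γ M B (z ω) (x ω) T j :=
  (h.continuous_prox hγ).measurable.comp (hx.sub ((measurable_levelEstimator hG
    (h.measurable_extrapolate hγ hG hx hz B T) hz M B (T + B) j).const_smul γ))

theorem RegularVI.measurable_nextPoint_comp (h : RegularVI X F r xs L μF μr) (hγ : 0 ≤ γ)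
    (hG : Measurable fun p : E × Z => G p.1 p.2) (hx : Measurable x)
    (hz : Measurable z) {T j : Ω → ℕ} (hT : Measurable T) (hj : Measurable j) (M : ℝ) (B : ℕ) :
    Measurable fun ω => nextPoint X r G γ M B (z ω) (x ω) (T ω) (j ω) :=
  measurable_comp_countable (ι := ℕ × ℕ)
    (f := fun q ω => nextPoint X r G γ M B (z ω) (x ω) q.1 q.2) (N := fun ω => (T ω, j ω))
    (fun q => h.measurable_nextPoint hγ hG hx hz M B q.1 q.2) (hT.prodMk hj)

theorem RegularVI.measurable_egState (h : RegularVI X F r xs L μF μr) (hγ : 0 ≤ γ)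
    (hG : Measurable fun p : E × Z => G p.1 p.2) (hz : Measurable z) {j : Ω → ℕ → ℕ}
    (hj : Measurable j) (M : ℝ) (B : ℕ) (x0 : E) (k : ℕ) :
    Measurable fun ω => egState X r G γ M B x0 (z ω) (j ω) k := by
  induction k with
  | zero => exact measurable_const
  | succ k ih =>
    have hjk : Measurable fun ω => j ω k := (measurable_pi_apply k).comp hj
    simp only [egState_succ]
    refine Measurable.prodMk ?_ ?_
    · exact h.measurable_nextPoint_comp hγ hG ih.fst hz ih.snd hjk M B
    · exact (ih.snd.add_const B).add
        ((measurable_of_countable fun i : ℕ => 2 ^ i * B).comp hjk)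

end Measurability

/-! ### Adaptedness and boundedness through one iteration -/

section Step

variable {E : Type*} [NormedAddCommGroup E] [InnerProductSpace ℝ E] [MeasurableSpace E]
  [ProperSpace E] [BorelSpace E] {Z : Type*} [MeasurableSpace Z] {G : E → Z → E}
  {X : Set E} {F : E → E} {r : E → ℝ} {xs : E} {γ μF μr L σ Δ : ℝ}
  {π : Measure Z} [IsProbabilityMeasure π]

theorem IsAdaptedPoint.extrapolate (h : RegularVI X F r xs L μF μr)
    (hG : IsOracle X F xs σ Δ π G) (hγ : 0 ≤ γ) (hL : 0 ≤ L) {B : ℕ} (hB : 1 ≤ B) {T : ℕ} {R : ℝ}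
    {ξ : (ℕ → Z) → E} (hξ : IsAdaptedPoint X xs T R ξ) :
    IsAdaptedPoint X xs (T + B) (R + γ * (√(σ ^ 2 + Δ ^ 2 * R ^ 2) + L * R))
      (fun p => extrapolate X r G γ B p (ξ p) T) where
  measurable := h.measurable_extrapolate hγ hG.measurable hξ.measurable measurable_id B T
  determined p := by
    simp only [MarkovVI.extrapolate]
    rw [hξ.determined.mono (Nat.le_add_right T B) p]
    have := determinedBy_batchMean (G := G) (B := B) hξ.determined p
    simp only [hξ.determined.mono (Nat.le_add_right T B) p] at this
    rw [this]
  mem p := h.prox_mem hγ _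
  norm_le p := by
    refine (h.norm_prox_sub_solution_le hγ _ _).trans (add_le_add (hξ.norm_le p)
      (mul_le_mul_of_nonneg_left ?_ hγ))
    have hN := hG.isNoise hξ
    refine (norm_sub_le_norm_sub_add_norm_sub _ (F (ξ p)) _).trans (add_le_add ?_ ?_)
    · rw [hG.batchMean_sub hξ.mem hB]
      exact (hN.norm_noiseMean_le B p).trans (hN.scale_le p)
    · exact (h.lipschitz _ (hξ.mem p) _ h.mem).trans
        (mul_le_mul_of_nonneg_left (hξ.norm_le p) hL)

/-- The radius `R'` is chosen before `T`, `ξ` and `j`. This uniformity bounds the iterates over all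
level sequences at once, which makes the integrals over the levels legitimate. -/
theorem IsAdaptedPoint.exists_nextPoint (h : RegularVI X F r xs L μF μr)
    (hG : IsOracle X F xs σ Δ π G) (hγ : 0 ≤ γ) (hL : 0 ≤ L) {M : ℝ} (hM : 2 ≤ M) {B : ℕ}
    (hB : 1 ≤ B) (R : ℝ) : ∃ R', ∀ (T : ℕ) (ξ : (ℕ → Z) → E) (j : ℕ),
      IsAdaptedPoint X xs T R ξ → IsAdaptedPoint X xs (T + B + 2 ^ j * B) R'
        (fun p => nextPoint X r G γ M B p (ξ p) T j) := by
  set R₁ := R + γ * (√(σ ^ 2 + Δ ^ 2 * R ^ 2) + L * R) with hR₁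
  refine ⟨R + γ * ((1 + 2 * M) * √(σ ^ 2 + Δ ^ 2 * R₁ ^ 2) + L * R₁), fun T ξ j hξ => ?_⟩
  have hη := hξ.extrapolate h hG hγ hL hB
  rw [← hR₁] at hη
  refine ⟨h.measurable_nextPoint hγ hG.measurable hξ.measurable measurable_id M B T j,
    fun p => ?_, fun p => h.prox_mem hγ _, fun p => ?_⟩
  · have h1 := determinedBy_levelEstimator (G := G) (M := M) (n := T + B + 2 ^ j * B)
      hη.determined le_rfl p
    simp only at h1
    rw [nextPoint, h1, hξ.determined.mono (by omega) p, nextPoint]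
  · refine (h.norm_prox_sub_solution_le hγ _ _).trans (add_le_add (hξ.norm_le p)
      (mul_le_mul_of_nonneg_left ?_ hγ))
    have hN := hG.isNoise hη
    refine (norm_sub_le_norm_sub_add_norm_sub _
      (F (MarkovVI.extrapolate X r G γ B p (ξ p) T)) _).trans (add_le_add ?_ ?_)
    · rw [hG.levelEstimator_sub (ξ := fun p => MarkovVI.extrapolate X r G γ B p (ξ p) T) hη.mem hB]
      exact (hN.norm_levelNoise_le hM B j p).trans
        (mul_le_mul_of_nonneg_left (hN.scale_le p) (by linarith))
    · exact (h.lipschitz _ (hη.mem p) _ h.mem).trans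
        (mul_le_mul_of_nonneg_left (hη.norm_le p) hL)

end Step

/-! ### Mean descent for frozen past levels -/

section ExpectedStep

variable {E : Type*} [NormedAddCommGroup E] [InnerProductSpace ℝ E] [MeasurableSpace E]
  [ProperSpace E] [BorelSpace E] {Z : Type*} [MeasurableSpace Z] {G : E → Z → E}
  {X : Set E} {F : E → E} {r : E → ℝ} {xs : E} {γ μF μr L σ Δ : ℝ}
  {π : Measure Z} [IsProbabilityMeasure π] {Q : Kernel Z Z} [IsMarkovKernel Q]
  {Ω : Type*} [MeasurableSpace Ω] {P : Measure Ω} [IsProbabilityMeasure P] {ζ : ℕ → Ω → Z} {τ : ℕ}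
  {ν : Measure ℕ} [IsProbabilityMeasure ν]

omit [InnerProductSpace ℝ E] [ProperSpace E] in
theorem IsAdaptedPoint.integrable_sq {T : ℕ} {R : ℝ} {ξ : (ℕ → Z) → E} [SecondCountableTopology E]
    (hξ : IsAdaptedPoint X xs T R ξ) (hζ : ∀ n, Measurable (ζ n)) :
    Integrable (fun ω => ‖ξ (fun i => ζ i ω) - xs‖ ^ 2) P := by
  refine integrable_of_abs_le (((hξ.measurable.sub_const xs).norm.pow_const 2).comp
    (measurable_pi_lambda _ hζ)) (s := R ^ 2) fun ω => ?_
  rw [abs_of_nonneg (sq_nonneg _)]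
  exact pow_le_pow_left₀ (norm_nonneg _) (hξ.norm_le _) 2

omit [InnerProductSpace ℝ E] [ProperSpace E] in
theorem IsAdaptedPoint.integral_noiseScale_sq {T : ℕ} {R : ℝ} {ξ : (ℕ → Z) → E}
    [SecondCountableTopology E] (hξ : IsAdaptedPoint X xs T R ξ) (hζ : ∀ n, Measurable (ζ n)) :
    ∫ ω, noiseScale xs σ Δ (ξ fun i => ζ i ω) ^ 2 ∂P
      = σ ^ 2 + Δ ^ 2 * ∫ ω, ‖ξ (fun i => ζ i ω) - xs‖ ^ 2 ∂P := by
  simp only [noiseScale_sq]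
  rw [integral_add (integrable_const _) ((hξ.integrable_sq hζ).const_mul _), integral_const_mul]
  simp

/-- The pathwise descent is averaged over the chain and the current level, and the noise terms are
replaced by their bounds. `V` and `D` are the mean squared distances from the extrapolated point to
`xs` and to the current point; hiding that point leaves only real arithmetic. -/
theorem expected_descent (h : RegularVI X F r xs L μF μr)
    (hG : IsOracle X F xs σ Δ π G) (hζ : IsMarkovChain P Q ζ) (hQ : UniformlyErgodic Q τ)
    (hπ : Kernel.Invariant Q π) (hν : ∀ i, 1 ≤ i → ν {i} = (1 / 2) ^ i)
    (hγ : 0 < γ) (hL : 0 ≤ L) (hμr : 0 ≤ μr) (hμ : 0 < μF + μr) {M : ℝ} (hM : 2 ≤ M) {B : ℕ}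
    (hB : 1 ≤ B) {T : ℕ} {R : ℝ} {ξ : (ℕ → Z) → E} (hξ : IsAdaptedPoint X xs T R ξ) :
    ∃ U V D : ℝ, U = ∫ ω, ‖ξ (fun i => ζ i ω) - xs‖ ^ 2 ∂P ∧ 0 ≤ U ∧ 0 ≤ V ∧ 0 ≤ D ∧
      3 / 4 * U - 3 * D ≤ V ∧
      ∫ j, ∫ ω, ‖nextPoint X r G γ M B (fun i => ζ i ω) (ξ fun i => ζ i ω) T j - xs‖ ^ 2 ∂P ∂ν ≤
        U - (1 - 3 * (γ * L) ^ 2) * D - γ * (2 * μF + μr) * V + γ * (μF + μr) / 8 * V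
          + 512 * γ * τ ^ 2 / ((μF + μr) * M ^ 2 * B ^ 2) * (σ ^ 2 + Δ ^ 2 * V)
          + 24 * γ ^ 2 * (τ / B) * (σ ^ 2 + Δ ^ 2 * U)
          + 3 * γ ^ 2 * ((16 + 96 * topLevel M) * (τ / B)) * (σ ^ 2 + Δ ^ 2 * V) := by
  have hη := hξ.extrapolate h hG hγ.le hL hB
  set R₁ := R + γ * (√(σ ^ 2 + Δ ^ 2 * R ^ 2) + L * R)
  set η : (ℕ → Z) → E := fun p => extrapolate X r G γ B p (ξ p) T with hηdef
  have hN1 := hG.isNoise hξ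
  have hN2 := hG.isNoise hη
  set H1 := oracleNoise π G ξ
  set H2 := oracleNoise π G η
  set K2 := √(σ ^ 2 + Δ ^ 2 * R₁ ^ 2)
  have hpath := hζ.measurable_path
  have hU := hξ.integrable_sq (P := P) hζ.measurable
  have hV := hη.integrable_sq (P := P) hζ.measurable
  have hDd : ∀ p, ‖ξ p - η p‖ ≤ R + R₁ := fun p => by
    have h1 := norm_sub_le_norm_sub_add_norm_sub (ξ p) xs (η p)
    rw [norm_sub_rev xs] at h1
    exact h1.trans (add_le_add (hξ.norm_le p) (hη.norm_le p))
  have hD : Integrable (fun ω => ‖ξ (fun i => ζ i ω) - η fun i => ζ i ω‖ ^ 2) P := by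
    refine integrable_of_abs_le (((hξ.measurable.sub hη.measurable).norm.pow_const 2).comp hpath)
      (s := (R + R₁) ^ 2) fun ω => ?_
    rw [abs_of_nonneg (sq_nonneg _)]
    exact pow_le_pow_left₀ (norm_nonneg _) (hDd _) 2
  have hE1 : Integrable (fun ω => ‖noiseMean H1 T B fun i => ζ i ω‖ ^ 2) P := by
    refine integrable_of_abs_le (((hN1.measurable_noiseMean B).norm.pow_const 2).comp hpath)
      (s := √(σ ^ 2 + Δ ^ 2 * R ^ 2) ^ 2) fun ω => ?_
    rw [abs_of_nonneg (sq_nonneg _)]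
    exact pow_le_pow_left₀ (norm_nonneg _) ((hN1.norm_noiseMean_le _ _).trans (hN1.scale_le _)) 2
  set KL := (1 + 2 * M) * K2 with hKL
  have hLn : ∀ j p, ‖levelNoise H2 M B (T + B) j p‖ ≤ KL := fun j p =>
    (hN2.norm_levelNoise_le hM B j p).trans
      (mul_le_mul_of_nonneg_left (hN2.scale_le p) (by linarith))
  have hIb : ∀ j p, |inner ℝ (η p - xs) (levelNoise H2 M B (T + B) j p)| ≤ R₁ * KL := fun j p =>
    (abs_real_inner_le_norm _ _).trans (mul_le_mul (hη.norm_le p) (hLn j p) (norm_nonneg _)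
      ((norm_nonneg _).trans (hη.norm_le p)))
  have hSb : ∀ j p, |‖levelNoise H2 M B (T + B) j p‖ ^ 2| ≤ KL ^ 2 := fun j p => by
    rw [abs_of_nonneg (sq_nonneg _)]
    exact pow_le_pow_left₀ (norm_nonneg _) (hLn j p) 2
  have hI : ∀ j, Integrable (fun ω => inner ℝ (η (fun i => ζ i ω) - xs)
      (levelNoise H2 M B (T + B) j fun i => ζ i ω)) P := fun j =>
    integrable_of_abs_le (((hη.measurable.sub_const xs).inner
      (hN2.measurable_levelNoise M B j)).comp hpath) fun ω => hIb j _
  have hS : ∀ j, Integrable (fun ω => ‖levelNoise H2 M B (T + B) j fun i => ζ i ω‖ ^ 2) P :=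
    fun j => integrable_of_abs_le (((hN2.measurable_levelNoise M B j).norm.pow_const 2).comp hpath)
      fun ω => hSb j _
  set U := ∫ ω, ‖ξ (fun i => ζ i ω) - xs‖ ^ 2 ∂P with hUd
  set V := ∫ ω, ‖η (fun i => ζ i ω) - xs‖ ^ 2 ∂P with hVd
  set D := ∫ ω, ‖ξ (fun i => ζ i ω) - η fun i => ζ i ω‖ ^ 2 ∂P with hDdef
  set N1 := ∫ ω, ‖noiseMean H1 T B fun i => ζ i ω‖ ^ 2 ∂P with hN1d
  set e : ℕ → ℝ := fun j => ∫ ω, inner ℝ (η (fun i => ζ i ω) - xs)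
      (levelNoise H2 M B (T + B) j fun i => ζ i ω) ∂P with he
  set v : ℕ → ℝ := fun j => ∫ ω, ‖levelNoise H2 M B (T + B) j fun i => ζ i ω‖ ^ 2 ∂P with hv
  refine ⟨U, V, D, rfl, integral_nonneg fun _ => sq_nonneg _, integral_nonneg fun _ => sq_nonneg _,
    integral_nonneg fun _ => sq_nonneg _, ?_, ?_⟩
  · rw [hUd, hDdef, ← integral_const_mul, ← integral_const_mul,
      ← integral_sub (hU.const_mul _) (hD.const_mul _)]
    refine integral_mono ((hU.const_mul _).sub (hD.const_mul _)) hV fun ω => ?_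
    have h1 := norm_sub_le_norm_sub_add_norm_sub (ξ fun i => ζ i ω) (η fun i => ζ i ω) xs
    have h2 := pow_le_pow_left₀ (norm_nonneg _) h1 2
    simp only
    -- Young's inequality in the form `(d + v)² ≤ 4 d² + (4/3) v²`.
    nlinarith [sq_nonneg (3 * ‖ξ (fun i => ζ i ω) - η fun i => ζ i ω‖
      - ‖η (fun i => ζ i ω) - xs‖)]
  have hstep : ∀ j, ∫ ω, ‖nextPoint X r G γ M B (fun i => ζ i ω) (ξ fun i => ζ i ω) T j
      - xs‖ ^ 2 ∂P ≤ U - (1 - 3 * (γ * L) ^ 2) * D - γ * (2 * μF + μr) * V - 2 * γ * e j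
        + 3 * γ ^ 2 * N1 + 3 * γ ^ 2 * v j := by
    intro j
    have i1 := hU.sub (hD.const_mul (1 - 3 * (γ * L) ^ 2))
    have i2 := i1.sub (hV.const_mul (γ * (2 * μF + μr)))
    have i3 := i2.sub ((hI j).const_mul (2 * γ))
    have i4 := i3.add (hE1.const_mul (3 * γ ^ 2))
    have i5 := i4.add ((hS j).const_mul (3 * γ ^ 2))
    refine (integral_mono_of_nonneg (Filter.Eventually.of_forall fun ω => sq_nonneg _) i5
      (Filter.Eventually.of_forall fun ω => ?_)).trans (le_of_eq ?_)
    · have h1 := h.extragradient_descent hγ hμr (hξ.mem fun i => ζ i ω)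
        (batchMean G (ξ fun i => ζ i ω) (fun i => ζ i ω) T B)
        (levelEstimator G M B (η fun i => ζ i ω) (fun i => ζ i ω) (T + B) j)
      rw [hG.batchMean_sub hξ.mem hB] at h1
      have h2 := hG.levelEstimator_sub (T := T + B) hη.mem hB M j (fun i => ζ i ω)
      change _ ≤ ‖ξ (fun i => ζ i ω) - xs‖ ^ 2
        - (1 - 3 * (γ * L) ^ 2) * ‖ξ (fun i => ζ i ω) - η fun i => ζ i ω‖ ^ 2
        - γ * (2 * μF + μr) * ‖η (fun i => ζ i ω) - xs‖ ^ 2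
        - 2 * γ * inner ℝ (η (fun i => ζ i ω) - xs) (levelEstimator G M B (η fun i => ζ i ω)
          (fun i => ζ i ω) (T + B) j - F (η fun i => ζ i ω))
        + 3 * γ ^ 2 * ‖noiseMean H1 T B fun i => ζ i ω‖ ^ 2
        + 3 * γ ^ 2 * ‖levelEstimator G M B (η fun i => ζ i ω)
          (fun i => ζ i ω) (T + B) j - F (η fun i => ζ i ω)‖ ^ 2 at h1
      rw [h2] at h1
      exact h1
    · rw [integral_add' i4 ((hS j).const_mul _), integral_add' i3 (hE1.const_mul _),
        integral_sub' i2 ((hI j).const_mul _), integral_sub' i1 (hV.const_mul _),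
        integral_sub' hU (hD.const_mul _)]
      simp only [integral_const_mul]
      rfl
  have hei : Integrable e ν := integrable_nat_of_abs_le (s := R₁ * KL) fun j => by
    have := norm_integral_le_of_norm_le_const (μ := P) (f := fun ω => inner ℝ
      (η (fun i => ζ i ω) - xs) (levelNoise H2 M B (T + B) j fun i => ζ i ω))
      (Filter.Eventually.of_forall fun ω => hIb j _)
    simpa using this
  have hvi : Integrable v ν := integrable_nat_of_abs_le (s := KL ^ 2) fun j => by
    have := norm_integral_le_of_norm_le_const (μ := P) (f := fun ω =>
      ‖levelNoise H2 M B (T + B) j fun i => ζ i ω‖ ^ 2)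
      (Filter.Eventually.of_forall fun ω => hSb j _)
    simpa using this
  have htot : ∫ j, ∫ ω, ‖nextPoint X r G γ M B (fun i => ζ i ω) (ξ fun i => ζ i ω) T j
      - xs‖ ^ 2 ∂P ∂ν ≤ U - (1 - 3 * (γ * L) ^ 2) * D - γ * (2 * μF + μr) * V
        + 3 * γ ^ 2 * N1 - 2 * γ * ∫ j, e j ∂ν + 3 * γ ^ 2 * ∫ j, v j ∂ν := by
    have i1 := (integrable_const (μ := ν) (U - (1 - 3 * (γ * L) ^ 2) * D - γ * (2 * μF + μr) * V
        + 3 * γ ^ 2 * N1)).sub (hei.const_mul (2 * γ))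
    have i2 := i1.add (hvi.const_mul (3 * γ ^ 2))
    refine (integral_mono_of_nonneg (Filter.Eventually.of_forall fun j =>
      integral_nonneg fun ω => sq_nonneg _) i2
      (Filter.Eventually.of_forall fun j => ?_)).trans (le_of_eq ?_)
    · refine (hstep j).trans (le_of_eq ?_)
      simp only [Pi.add_apply, Pi.sub_apply]
      ring
    · rw [integral_add' i1 (hvi.const_mul _), integral_sub' (integrable_const _)
        (hei.const_mul _)]
      simp only [integral_const_mul, integral_const, probReal_univ, one_smul]
  have hs2 := hη.integral_noiseScale_sq (P := P) (σ := σ) (Δ := Δ) hζ.measurable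
  have b1 : N1 ≤ 8 * τ / B * (σ ^ 2 + Δ ^ 2 * U) := by
    have := hN1.integral_norm_noiseMean_sq_le hζ hQ hπ B
    rwa [hξ.integral_noiseScale_sq hζ.measurable] at this
  have b2 : ∫ j, v j ∂ν ≤ (16 + 96 * topLevel M) * (τ / B) * (σ ^ 2 + Δ ^ 2 * V) := by
    have := hN2.integral_norm_levelNoise_sq_le hζ hQ hπ hν hM hB
    rwa [hs2] at this
  -- Young's inequality with weight `γ (μF + μr) / 8`, small enough to be absorbed by the
  -- contraction; completing the square in `e1` produces the constant `512`.
  have b3 : -(2 * γ * ∫ j, e j ∂ν) ≤ γ * (μF + μr) / 8 * V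
      + 512 * γ * τ ^ 2 / ((μF + μr) * M ^ 2 * B ^ 2) * (σ ^ 2 + Δ ^ 2 * V) := by
    have h1 := hN2.abs_integral_inner_levelNoise_le hζ hQ hπ hν hM hB
      (w := fun p => η p - xs) (hη.measurable.sub_const xs)
      (fun p => by simp only [hη.determined p]) hη.norm_le
    have h2 : -(2 * γ * ∫ j, e j ∂ν) ≤ 2 * γ * (8 * τ / (M * B) *
        ∫ ω, ‖η (fun i => ζ i ω) - xs‖ * noiseScale xs σ Δ (η fun i => ζ i ω) ∂P) := by
      have := (abs_le.1 h1).1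
      nlinarith
    refine h2.trans ?_
    rw [← hs2, ← mul_assoc, ← integral_const_mul, ← integral_const_mul, ← integral_const_mul]
    have hsi : Integrable (fun ω => noiseScale xs σ Δ (η fun i => ζ i ω) ^ 2) P := by
      simp only [noiseScale_sq]
      exact (integrable_const _).add (hV.const_mul _)
    rw [← integral_add (hV.const_mul _) (hsi.const_mul _)]
    refine integral_mono_of_nonneg (Filter.Eventually.of_forall fun ω => ?_)
      ((hV.const_mul _).add (hsi.const_mul _)) (Filter.Eventually.of_forall fun ω => ?_)
    · have : 0 ≤ noiseScale xs σ Δ (η fun i => ζ i ω) := Real.sqrt_nonneg _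
      have : 0 < M := by linarith
      simp only [Pi.zero_apply]
      positivity
    · simp only
      set y := ‖η (fun i => ζ i ω) - xs‖
      set s := noiseScale xs σ Δ (η fun i => ζ i ω)
      set μ := μF + μr
      have hM0 : 0 < M := by linarith
      have hB0 : (0 : ℝ) < B := by exact_mod_cast hB
      have e1 : γ * μ / 8 * y ^ 2 + 512 * γ * τ ^ 2 / (μ * M ^ 2 * B ^ 2) * s ^ 2
          - 2 * γ * (8 * τ / (M * B)) * (y * s)
          = γ * μ / 8 * (y - 64 * τ / (μ * M * B) * s) ^ 2 := by
        field_simp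
        ring
      have e2 : 0 ≤ γ * μ / 8 * (y - 64 * τ / (μ * M * B) * s) ^ 2 := by positivity
      linarith
  have b1' := mul_le_mul_of_nonneg_left b1 (by positivity : 0 ≤ 3 * γ ^ 2)
  have b2' := mul_le_mul_of_nonneg_left b2 (by positivity : 0 ≤ 3 * γ ^ 2)
  have e1 : 3 * γ ^ 2 * (8 * τ / B * (σ ^ 2 + Δ ^ 2 * U))
      = 24 * γ ^ 2 * (τ / B) * (σ ^ 2 + Δ ^ 2 * U) := by ring
  rw [e1] at b1'
  rw [← mul_assoc] at b2'
  linarith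

end ExpectedStep

/-! ### From mean descent to a geometric bound -/

section Contraction

/-- The constant in front of the noise level in the recursion. -/
noncomputable def noiseConst (a : ℝ) : ℝ := 512 / a ^ 2 + 360

theorem noiseConst_ge {a : ℝ} : 360 ≤ noiseConst a := by
  have : 0 ≤ 512 / a ^ 2 := by positivity
  unfold noiseConst
  linarith

/-- The coefficient of `-V` is at least `γμ`; Young's term takes `1/8` of it and the `Δ²` noise
`1/32`, leaving `27/32`. Trading `V` for `3/4 * U - 3 * D` yields `81/128 * γμ * U`, which still
exceeds `1/2 + 1/32`; the extra `D` is covered by the coefficient of `-D`, close to one. -/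
theorem contraction_of_descent {a γ μF μr L σ Δ M τ b B l U V D W : ℝ} (ha : 0 < a) (hγ : 0 < γ)
    (hL : 0 ≤ L) (hμF : 0 ≤ μF) (hμ : 0 < μF + μr) (hτ : 0 ≤ τ)
    (hb : 1 ≤ b) (hM : 2 ≤ M) (hbB : b ≤ B) (hblB : b * l ≤ B)
    (hMa : a ^ 2 ≤ γ * (μF + μr) * M ^ 2)
    (h1 : γ * (μF + μr) ≤ 1 / (32 * noiseConst a)) (h2 : γ * L ≤ 1 / (32 * noiseConst a))
    (h3 : γ * (Δ ^ 2 * (τ / b) + Δ ^ 2 * (τ ^ 2 / b ^ 2))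
      ≤ 1 / (32 * noiseConst a) * (μF + μr))
    (hU : 0 ≤ U) (hV : 0 ≤ V) (hD : 0 ≤ D) (hUVD : 3 / 4 * U - 3 * D ≤ V)
    (hW : W ≤ U - (1 - 3 * (γ * L) ^ 2) * D - γ * (2 * μF + μr) * V + γ * (μF + μr) / 8 * V
          + 512 * γ * τ ^ 2 / ((μF + μr) * M ^ 2 * B ^ 2) * (σ ^ 2 + Δ ^ 2 * V)
          + 24 * γ ^ 2 * (τ / B) * (σ ^ 2 + Δ ^ 2 * U)
          + 3 * γ ^ 2 * ((16 + 96 * l) * (τ / B)) * (σ ^ 2 + Δ ^ 2 * V)) :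
    W ≤ (1 - γ * (μF + μr) / 2) * U
      + noiseConst a * γ ^ 2 * (σ ^ 2 * (τ / b) + σ ^ 2 * (τ ^ 2 / b ^ 2)) := by
  set μ := μF + μr with hμdef
  set K := noiseConst a with hK
  have hK360 : 360 ≤ K := noiseConst_ge
  have hb0 : 0 < b := by linarith
  have hB0 : 0 < B := by linarith
  have hM0 : 0 < M := by linarith
  set Λ := τ / b + τ ^ 2 / b ^ 2 with hΛ
  have hΛ0 : 0 ≤ Λ := by positivity
  have hτbB : τ / B ≤ τ / b := div_le_div_of_nonneg_left hτ hb0 hbB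
  have hτb0 : 0 ≤ τ ^ 2 / b ^ 2 := by positivity
  -- The lower bound on `M` enters here: `γ μ M² ≥ a²` gains the missing factor `γ` in the bias
  -- term.
  have k1 : 512 * γ * τ ^ 2 / (μ * M ^ 2 * B ^ 2) ≤ 512 / a ^ 2 * γ ^ 2 * (τ ^ 2 / b ^ 2) := by
    have e : 512 / a ^ 2 * γ ^ 2 * (τ ^ 2 / b ^ 2) = 512 * γ ^ 2 * τ ^ 2 / (a ^ 2 * b ^ 2) := by
      field_simp
    rw [e, div_le_div_iff₀ (by positivity) (by positivity)]
    have hbB2 : b ^ 2 ≤ B ^ 2 := pow_le_pow_left₀ hb0.le hbB 2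
    have := mul_le_mul hMa hbB2 (by positivity) (by positivity)
    have := mul_le_mul_of_nonneg_left this (by positivity : 0 ≤ 512 * γ * τ ^ 2)
    linarith
  have k2 : 24 * γ ^ 2 * (τ / B) ≤ 24 * γ ^ 2 * Λ :=
    mul_le_mul_of_nonneg_left (by linarith) (by positivity)
  -- The batch size `B ≥ b * l` cancels the number of levels; with `b ≤ B` this gives `16 + 96 =
  -- 112`.
  have k3 : 3 * γ ^ 2 * ((16 + 96 * l) * (τ / B)) ≤ 336 * γ ^ 2 * (τ / b) := by
    have e : (16 + 96 * l) * (τ / B) ≤ 112 * (τ / b) := by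
      have e1 : (16 + 96 * l) * (τ / B) = (16 + 96 * l) * τ / B := by ring
      have e2 : 112 * (τ / b) = 112 * τ / b := by ring
      rw [e1, e2, div_le_div_iff₀ hB0 hb0]
      have := mul_le_mul_of_nonneg_left (by linarith : 16 * b + 96 * (b * l) ≤ 112 * B) hτ
      linarith
    have := mul_le_mul_of_nonneg_left e (by positivity : 0 ≤ 3 * γ ^ 2)
    linarith
  have k4 : 512 * γ * τ ^ 2 / (μ * M ^ 2 * B ^ 2) + 3 * γ ^ 2 * ((16 + 96 * l) * (τ / B))
      ≤ (K - 24) * (γ ^ 2 * Λ) := by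
    have e1 : 0 ≤ 512 / a ^ 2 * γ ^ 2 * (τ / b) := by positivity
    have e2 : 0 ≤ 336 * γ ^ 2 * (τ ^ 2 / b ^ 2) := by positivity
    have e3 : (K - 24) * (γ ^ 2 * Λ) = 512 / a ^ 2 * γ ^ 2 * (τ ^ 2 / b ^ 2)
        + 336 * γ ^ 2 * (τ / b) + 512 / a ^ 2 * γ ^ 2 * (τ / b)
        + 336 * γ ^ 2 * (τ ^ 2 / b ^ 2) := by
      rw [hK, noiseConst, hΛ]
      ring
    linarith
  have k5 : K * (γ ^ 2 * Λ * Δ ^ 2) ≤ γ * μ / 32 := by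
    have := mul_le_mul_of_nonneg_left h3 (by positivity : 0 ≤ K * γ)
    have e : K * γ * (1 / (32 * K) * μ) = γ * μ / 32 := by
      field_simp
    rw [e] at this
    refine le_trans (le_of_eq ?_) this
    rw [hΛ]
    ring
  have hc0 : 1 / (32 * K) ≤ 1 / 100 := by
    rw [div_le_div_iff₀ (by positivity) (by norm_num)]
    linarith
  have hLsq : (γ * L) ^ 2 ≤ (1 / 100) ^ 2 :=
    pow_le_pow_left₀ (by positivity) (h2.trans hc0) 2
  have hγμ : 0 < γ * μ := by positivity
  have hq : 0 ≤ γ ^ 2 * Λ * Δ ^ 2 := by positivity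
  have p1 := mul_le_mul_of_nonneg_right k4 (by positivity : 0 ≤ σ ^ 2 + Δ ^ 2 * V)
  have p2 := mul_le_mul_of_nonneg_right k2 (by positivity : 0 ≤ σ ^ 2 + Δ ^ 2 * U)
  have p3 : (K - 24) * (γ ^ 2 * Λ) * (Δ ^ 2 * V) ≤ γ * μ / 32 * V := by
    have : (K - 24) * (γ ^ 2 * Λ * Δ ^ 2) ≤ γ * μ / 32 := by linarith
    have := mul_le_mul_of_nonneg_right this hV
    linarith
  have p4 : 24 * γ ^ 2 * Λ * (Δ ^ 2 * U) ≤ γ * μ / 32 * U := by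
    have : 24 * (γ ^ 2 * Λ * Δ ^ 2) ≤ γ * μ / 32 := by
      have := mul_le_mul_of_nonneg_right (by linarith : 24 ≤ K) hq
      linarith
    have := mul_le_mul_of_nonneg_right this hU
    linarith
  have p5 : γ * μ * V ≤ γ * (2 * μF + μr) * V := by
    refine mul_le_mul_of_nonneg_right (mul_le_mul_of_nonneg_left ?_ hγ.le) hV
    rw [hμdef]
    linarith
  have p6 := mul_le_mul_of_nonneg_left hUVD (by positivity : 0 ≤ 27 / 32 * (γ * μ))
  have p7 : 81 / 32 * (γ * μ) * D ≤ (1 - 3 * (γ * L) ^ 2) * D :=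
    mul_le_mul_of_nonneg_right (by linarith) hD
  have p8 : 0 ≤ γ * μ * U := by positivity
  have e : K * γ ^ 2 * (σ ^ 2 * (τ / b) + σ ^ 2 * (τ ^ 2 / b ^ 2))
      = (K - 24) * (γ ^ 2 * Λ) * σ ^ 2 + 24 * γ ^ 2 * Λ * σ ^ 2 := by
    rw [hΛ]
    ring
  rw [e]
  linarith

theorem le_of_contraction {ρ c : ℝ} (hρ0 : 0 ≤ ρ) (hρ1 : ρ < 1) (hc : 0 ≤ c) {U : ℕ → ℝ}
    (h : ∀ n, U (n + 1) ≤ ρ * U n + c) (N : ℕ) : U N ≤ ρ ^ N * U 0 + c / (1 - ρ) := by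
  have h1 : 0 < 1 - ρ := by linarith
  induction N with
  | zero =>
    have : 0 ≤ c / (1 - ρ) := by positivity
    simpa using this
  | succ n ih =>
    have h2 := mul_le_mul_of_nonneg_left ih hρ0
    have h3 : ρ * (c / (1 - ρ)) + c = c / (1 - ρ) := by
      field_simp
      ring
    rw [pow_succ']
    linarith [h n]

end Contraction

/-! ### Resampling one level -/

section Resampling

variable {Ω : Type*} [MeasurableSpace Ω] {P : Measure Ω} [IsProbabilityMeasure P]

/-- The law of an independent sequence is invariant under resampling one coordinate. -/
theorem map_update_prod_map {α : Type*} [MeasurableSpace α] {J : ℕ → Ω → α}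
    (hJ : ∀ k, Measurable (J k)) (hind : iIndepFun J P) (k : ℕ) :
    ((P.map fun ω n => J n ω).prod (P.map (J k))).map
      (fun q : (ℕ → α) × α => Function.update q.1 k q.2) = P.map fun ω n => J n ω := by
  have hp : ∀ n, IsProbabilityMeasure (P.map (J n)) := fun n =>
    Measure.isProbabilityMeasure_map (hJ n).aemeasurable
  have hm : Measurable fun q : (ℕ → α) × α => Function.update q.1 k q.2 := measurable_update'
  rw [(iIndepFun_iff_map_fun_eq_infinitePi_map hJ).1 hind]
  -- A product law is determined by finite cylinders. The preimage of a cylinder drops the `k`-th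
  -- constraint from the sequence and imposes it on the fresh coordinate.
  refine Measure.eq_infinitePi _ fun s t ht => ?_
  have e : (fun q : (ℕ → α) × α => Function.update q.1 k q.2) ⁻¹' Set.pi s t
      = Set.pi (s.erase k) t ×ˢ (if k ∈ s then t k else Set.univ) := by
    ext ⟨j, i⟩
    simp only [Set.mem_preimage, Set.mem_pi, Finset.mem_coe, Set.mem_prod, Finset.mem_erase]
    constructor
    · intro h
      refine ⟨fun n hn => by simpa [Function.update_of_ne hn.1] using h n hn.2, ?_⟩
      split_ifs with hk
      · simpa using h k hk
      · trivial
    · rintro ⟨h1, h2⟩ n hn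
      by_cases hnk : n = k
      · subst hnk
        simpa [hn] using h2
      · simpa [Function.update_of_ne hnk] using h1 n ⟨hnk, hn⟩
  rw [Measure.map_apply hm (MeasurableSet.pi s.countable_toSet fun i _ => ht i), e,
    Measure.prod_prod, Measure.infinitePi_pi _ (fun i _ => ht i)]
  split_ifs with hk
  · rw [Finset.prod_erase_mul _ _ hk]
  · rw [measure_univ, mul_one, Finset.erase_eq_of_notMem hk]

end Resampling

/-! ### The error recursion with random levels -/

section Recursion

/-- The number of samples used by the first `k` iterations, for given levels `j`. -/
def sampleCount (B : ℕ) (j : ℕ → ℕ) : ℕ → ℕ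
  | 0 => 0
  | k + 1 => sampleCount B j k + B + 2 ^ j k * B

section

variable {E : Type*} [NormedAddCommGroup E] [InnerProductSpace ℝ E] {Z : Type*}
  (X : Set E) (r : E → ℝ) (G : E → Z → E) (γ M : ℝ) (B : ℕ) (x0 : E) (z : ℕ → Z)

theorem egState_snd (j : ℕ → ℕ) (k : ℕ) :
    (egState X r G γ M B x0 z j k).2 = sampleCount B j k := by
  induction k with
  | zero => rfl
  | succ k ih => rw [egState_succ, sampleCount, ih]

theorem egState_congr {j j' : ℕ → ℕ} {k : ℕ} (h : ∀ i < k, j i = j' i) :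
    egState X r G γ M B x0 z j k = egState X r G γ M B x0 z j' k := by
  induction k with
  | zero => rfl
  | succ k ih =>
    rw [egState_succ, egState_succ, ih fun i hi => h i (by omega), h k (by omega)]

theorem egIterate_succ (j : ℕ → ℕ) (k : ℕ) :
    egIterate X r G γ M B x0 z j (k + 1) =
      nextPoint X r G γ M B z (egIterate X r G γ M B x0 z j k) (sampleCount B j k) (j k) := by
  rw [egIterate, egState_succ, egState_snd, egIterate]

/-- The `k`-th iterate and counter use only levels of index below `k`, so resampling level `k`
affects just the last update. -/
theorem egIterate_update_succ (j : ℕ → ℕ) (k i : ℕ) :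
    egIterate X r G γ M B x0 z (Function.update j k i) (k + 1) =
      nextPoint X r G γ M B z (egIterate X r G γ M B x0 z j k) (sampleCount B j k) i := by
  have h := egState_congr X r G γ M B x0 z (j := Function.update j k i) (j' := j) (k := k)
    fun n hn => Function.update_of_ne hn.ne _ _
  rw [egIterate_succ, Function.update_self, ← egState_snd X r G γ M B x0 z, egIterate, h,
    egState_snd, egIterate]

end

variable {E : Type*} [NormedAddCommGroup E] [InnerProductSpace ℝ E] [MeasurableSpace E]
  [ProperSpace E] [BorelSpace E] {Z : Type*} [MeasurableSpace Z] {G : E → Z → E}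
  {X : Set E} {F : E → E} {r : E → ℝ} {xs x0 : E} {γ μF μr L σ Δ M : ℝ} {B : ℕ}
  {π : Measure Z} [IsProbabilityMeasure π]

theorem RegularVI.measurable_egIterate (h : RegularVI X F r xs L μF μr) (hγ : 0 ≤ γ)
    (hG : Measurable fun p : E × Z => G p.1 p.2) {Ω : Type*} [MeasurableSpace Ω] {z : Ω → ℕ → Z}
    (hz : Measurable z) {j : Ω → ℕ → ℕ} (hj : Measurable j) (M : ℝ) (B : ℕ) (x0 : E) (k : ℕ) :
    Measurable fun ω => egIterate X r G γ M B x0 (z ω) (j ω) k :=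
  (h.measurable_egState hγ hG hz hj M B x0 k).fst

theorem exists_isAdaptedPoint_egIterate (h : RegularVI X F r xs L μF μr)
    (hG : IsOracle X F xs σ Δ π G) (hγ : 0 ≤ γ) (hL : 0 ≤ L) (hM : 2 ≤ M)
    (hB : 1 ≤ B) (hx0 : x0 ∈ X) (k : ℕ) : ∃ R, ∀ j : ℕ → ℕ,
      IsAdaptedPoint X xs (sampleCount B j k) R
        (fun p : ℕ → Z => egIterate X r G γ M B x0 p j k) := by
  induction k with
  | zero => exact ⟨‖x0 - xs‖, fun j =>
      ⟨measurable_const, fun _ => rfl, fun _ => hx0, fun _ => le_rfl⟩⟩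
  | succ k ih =>
    obtain ⟨R, hR⟩ := ih
    obtain ⟨R', hR'⟩ := IsAdaptedPoint.exists_nextPoint h hG hγ hL hM hB R
    refine ⟨R', fun j => ?_⟩
    simp only [egIterate_succ]
    exact hR' _ _ (j k) (hR j)

variable {Ω : Type*} [MeasurableSpace Ω] {P : Measure Ω} {ζ : ℕ → Ω → Z} {J : ℕ → Ω → ℕ}

theorem IsGeometricLevels.measurable_seq (hJ : IsGeometricLevels P ζ J) :
    Measurable fun ω k => J k ω := measurable_pi_lambda _ hJ.measurable

theorem IsGeometricLevels.map_singleton (hJ : IsGeometricLevels P ζ J) (k i : ℕ) (hi : 1 ≤ i) :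
    P.map (J k) {i} = (1 / 2) ^ i := by
  rw [Measure.map_apply (hJ.measurable k) (measurableSet_singleton i), ← hJ.law k i hi]
  rfl

variable [IsProbabilityMeasure P]

/-- Integration over the chain first, then over the levels. -/
theorem IsGeometricLevels.integral_eq (hJ : IsGeometricLevels P ζ J) (hζ : ∀ n, Measurable (ζ n))
    {Φ : (ℕ → Z) → (ℕ → ℕ) → ℝ} (hΦ : Measurable (Function.uncurry Φ)) {K : ℝ}
    (hK : ∀ p j, |Φ p j| ≤ K) :
    ∫ ω, Φ (fun n => ζ n ω) (fun k => J k ω) ∂P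
      = ∫ j, ∫ ω, Φ (fun n => ζ n ω) j ∂P ∂(P.map fun ω k => J k ω) := by
  have hm : Measurable fun ω n => ζ n ω := measurable_pi_lambda _ hζ
  have hp1 : IsProbabilityMeasure (P.map fun ω n => ζ n ω) :=
    Measure.isProbabilityMeasure_map hm.aemeasurable
  have hp2 : IsProbabilityMeasure (P.map fun ω k => J k ω) :=
    Measure.isProbabilityMeasure_map hJ.measurable_seq.aemeasurable
  have h1 := (indepFun_iff_map_prod_eq_prod_map_map hm.aemeasurable
    hJ.measurable_seq.aemeasurable).1 hJ.indep_chain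
  have h2 : ∫ ω, Φ (fun n => ζ n ω) (fun k => J k ω) ∂P = ∫ q, Function.uncurry Φ q
      ∂(P.map fun ω => ((fun n => ζ n ω), (fun k => J k ω))) := by
    rw [integral_map (hm.prodMk hJ.measurable_seq).aemeasurable hΦ.aestronglyMeasurable]
    rfl
  rw [h2, h1, integral_prod_symm _ (integrable_of_abs_le hΦ fun q => hK q.1 q.2)]
  refine integral_congr_ae (Filter.Eventually.of_forall fun j => ?_)
  exact integral_map hm.aemeasurable
    (hΦ.comp (measurable_prodMk_right (y := j))).aestronglyMeasurable

/-- Resampling the `k`-th level. -/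
theorem IsGeometricLevels.integral_resample (hJ : IsGeometricLevels P ζ J) (k : ℕ)
    {g : (ℕ → ℕ) → ℝ} (hg : Measurable g) {K : ℝ} (hK : ∀ j, |g j| ≤ K) :
    ∫ j, g j ∂(P.map fun ω k => J k ω)
      = ∫ j, ∫ i, g (Function.update j k i) ∂(P.map (J k)) ∂(P.map fun ω k => J k ω) := by
  have hp1 : IsProbabilityMeasure (P.map (J k)) :=
    Measure.isProbabilityMeasure_map (hJ.measurable k).aemeasurable
  have hp2 : IsProbabilityMeasure (P.map fun ω k => J k ω) :=
    Measure.isProbabilityMeasure_map hJ.measurable_seq.aemeasurable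
  have hm : Measurable fun q : (ℕ → ℕ) × ℕ => Function.update q.1 k q.2 := measurable_update'
  conv_lhs => rw [← map_update_prod_map hJ.measurable hJ.indep k]
  rw [integral_map hm.aemeasurable hg.aestronglyMeasurable]
  exact integral_prod _ (integrable_of_abs_le (hg.comp hm) fun q => hK _)

/-- Independence lets the chain be integrated out for frozen levels, and resampling inserts an
independent copy of level `k`. A bound holding for every frozen sequence, averaged over the chain
and that copy, then passes to the actual process. -/
theorem IsGeometricLevels.integral_le_of_resample (hJ : IsGeometricLevels P ζ J)
    (hζ : ∀ n, Measurable (ζ n)) {Φ Ψ : (ℕ → Z) → (ℕ → ℕ) → ℝ}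
    (hΦ : Measurable (Function.uncurry Φ)) {KΦ : ℝ} (hKΦ : ∀ p j, |Φ p j| ≤ KΦ)
    (hΨ : Measurable (Function.uncurry Ψ)) {KΨ : ℝ} (hKΨ : ∀ p j, |Ψ p j| ≤ KΨ)
    (hΨ0 : ∀ p j, 0 ≤ Ψ p j) (k : ℕ) {ρ c : ℝ}
    (hstep : ∀ j, ∫ i, ∫ ω, Ψ (fun n => ζ n ω) (Function.update j k i) ∂P ∂(P.map (J k)) ≤
      ρ * ∫ ω, Φ (fun n => ζ n ω) j ∂P + c) :
    ∫ ω, Ψ (fun n => ζ n ω) (fun k => J k ω) ∂P ≤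
      ρ * ∫ ω, Φ (fun n => ζ n ω) (fun k => J k ω) ∂P + c := by
  have hp : IsProbabilityMeasure (P.map fun ω k => J k ω) :=
    Measure.isProbabilityMeasure_map hJ.measurable_seq.aemeasurable
  have hm : ∀ Θ : (ℕ → Z) → (ℕ → ℕ) → ℝ, Measurable (Function.uncurry Θ) →
      Measurable fun j => ∫ ω, Θ (fun n => ζ n ω) j ∂P := fun Θ hΘ => by
    have h1 : Measurable fun q : (ℕ → ℕ) × Ω => Θ (fun n => ζ n q.2) q.1 :=
      hΘ.comp ((measurable_pi_lambda _ fun n => (hζ n).comp measurable_snd).prodMk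
        measurable_fst)
    exact (h1.stronglyMeasurable.integral_prod_right' (ν := P)).measurable
  have hb : ∀ (Θ : (ℕ → Z) → (ℕ → ℕ) → ℝ) (K : ℝ), (∀ p j, |Θ p j| ≤ K) →
      ∀ j, |∫ ω, Θ (fun n => ζ n ω) j ∂P| ≤ K := fun Θ K hK j => by
    have := norm_integral_le_of_norm_le_const (μ := P) (f := fun ω => Θ (fun n => ζ n ω) j)
      (Filter.Eventually.of_forall fun ω => hK _ _)
    simpa using this
  have hi : Integrable (fun j => ∫ ω, Φ (fun n => ζ n ω) j ∂P) (P.map fun ω k => J k ω) :=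
    integrable_of_abs_le (hm Φ hΦ) (hb Φ KΦ hKΦ)
  rw [hJ.integral_eq hζ hΨ hKΨ, hJ.integral_eq hζ hΦ hKΦ,
    hJ.integral_resample k (hm Ψ hΨ) (hb Ψ KΨ hKΨ)]
  refine (integral_mono_of_nonneg (Filter.Eventually.of_forall fun j => integral_nonneg fun i =>
    integral_nonneg fun ω => hΨ0 _ _) ((hi.const_mul ρ).add (integrable_const c))
    (Filter.Eventually.of_forall hstep)).trans (le_of_eq ?_)
  rw [integral_add' (hi.const_mul ρ) (integrable_const c), integral_const_mul]
  simp

/-- One iteration of the algorithm contracts the mean squared error, up to the noise level, as soon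
as it does so for deterministic past levels. -/
theorem integral_egIterate_succ_le (h : RegularVI X F r xs L μF μr)
    (hG : IsOracle X F xs σ Δ π G) (hζ : ∀ n, Measurable (ζ n))
    (hJ : IsGeometricLevels P ζ J) (hγ : 0 ≤ γ) (hL : 0 ≤ L) (hM : 2 ≤ M) (hB : 1 ≤ B)
    (hx0 : x0 ∈ X) (k : ℕ) {ρ c : ℝ}
    (hstep : ∀ (T : ℕ) (R : ℝ) (ξ : (ℕ → Z) → E), IsAdaptedPoint X xs T R ξ →
      ∫ i, ∫ ω, ‖nextPoint X r G γ M B (fun n => ζ n ω) (ξ fun n => ζ n ω) T i - xs‖ ^ 2 ∂P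
        ∂(P.map (J k)) ≤ ρ * ∫ ω, ‖ξ (fun n => ζ n ω) - xs‖ ^ 2 ∂P + c) :
    ∫ ω, ‖egIterate X r G γ M B x0 (fun n => ζ n ω) (fun k => J k ω) (k + 1) - xs‖ ^ 2 ∂P ≤
      ρ * ∫ ω, ‖egIterate X r G γ M B x0 (fun n => ζ n ω) (fun k => J k ω) k - xs‖ ^ 2 ∂P + c := by
  have hmeas : ∀ n, Measurable (Function.uncurry fun (p : ℕ → Z) (j : ℕ → ℕ) =>
      ‖egIterate X r G γ M B x0 p j n - xs‖ ^ 2) := fun n =>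
    ((h.measurable_egIterate hγ hG.measurable measurable_fst measurable_snd M B x0 n).sub_const
      xs).norm.pow_const 2
  have hbd : ∀ n, ∃ K, ∀ (p : ℕ → Z) (j : ℕ → ℕ),
      |‖egIterate X r G γ M B x0 p j n - xs‖ ^ 2| ≤ K := fun n => by
    obtain ⟨R, hR⟩ := exists_isAdaptedPoint_egIterate (M := M) h hG hγ hL hM hB hx0 n
    refine ⟨R ^ 2, fun p j => ?_⟩
    rw [abs_of_nonneg (sq_nonneg _)]
    exact pow_le_pow_left₀ (norm_nonneg _) ((hR j).norm_le p) 2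
  obtain ⟨K₀, hK₀⟩ := hbd k
  obtain ⟨K₁, hK₁⟩ := hbd (k + 1)
  refine hJ.integral_le_of_resample hζ
    (Φ := fun p j => ‖egIterate X r G γ M B x0 p j k - xs‖ ^ 2)
    (Ψ := fun p j => ‖egIterate X r G γ M B x0 p j (k + 1) - xs‖ ^ 2)
    (hmeas k) hK₀ (hmeas (k + 1)) hK₁ (fun p j => sq_nonneg _) k
    fun j => ?_
  obtain ⟨R, hR⟩ := exists_isAdaptedPoint_egIterate (M := M) h hG hγ hL hM hB hx0 k
  refine (le_of_eq ?_).trans (hstep (sampleCount B j k) R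
    (fun p => egIterate X r G γ M B x0 p j k) (hR j))
  congr 1
  funext i
  congr 1
  funext ω
  rw [egIterate_update_succ]

end Recursion

end MarkovVI

/-! ### Choice of constants and conclusion -/

theorem mainTheorem8 (a A : ℝ) (ha : 0 < a) :
    -- `c` and `C` depend only on the constants `a`, `A` in the choice `M ≃ max{2, …}`
    ∃ c C : ℝ, 0 < c ∧ 0 < C ∧
    ∀ (d : ℕ) (X : Set (EuclideanSpace ℝ (Fin d)))
      (F : EuclideanSpace ℝ (Fin d) → EuclideanSpace ℝ (Fin d))
      (r : EuclideanSpace ℝ (Fin d) → ℝ) (xs x0 : EuclideanSpace ℝ (Fin d))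
      (L μF μr σ Δ : ℝ)
      (Z : Type*) [TopologicalSpace Z] [PolishSpace Z] [MeasurableSpace Z] [BorelSpace Z]
      (Q : ProbabilityTheory.Kernel Z Z) [ProbabilityTheory.IsMarkovKernel Q]
      (π : MeasureTheory.Measure Z) [MeasureTheory.IsProbabilityMeasure π] (τ : ℕ)
      (G : EuclideanSpace ℝ (Fin d) → Z → EuclideanSpace ℝ (Fin d))
      (Ω : Type*) [MeasurableSpace Ω]
      (P : MeasureTheory.Measure Ω) [MeasureTheory.IsProbabilityMeasure P]
      (ζ : ℕ → Ω → Z) (J : ℕ → Ω → ℕ)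
      (γ M : ℝ) (b B : ℕ),
      -- the variational inequality
      IsClosed X → Convex ℝ X → ConvexOn ℝ X r → LowerSemicontinuousOn r X →
      0 < L → MarkovVI.LipschitzOp X L F →
      0 ≤ μF → MarkovVI.StronglyMonotoneOp X μF F →
      0 ≤ μr → MarkovVI.StronglyConvexReg X μr r →
      0 < μF + μr →
      MarkovVI.IsSolution X F r xs →
      -- the Markovian noise
      MarkovVI.IsMarkovChain P Q ζ →
      ProbabilityTheory.Kernel.Invariant Q π →
      MarkovVI.UniformlyErgodic Q τ →
      Measurable (fun p : EuclideanSpace ℝ (Fin d) × Z => G p.1 p.2) →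
      (∀ x ∈ X, ∫ z, G x z ∂π = F x) →
      (∀ x ∈ X, ∀ z, ‖G x z - F x‖ ^ 2 ≤ σ ^ 2 + Δ ^ 2 * ‖x - xs‖ ^ 2) →
      -- the random levels, the starting point and the parameters of the algorithm
      MarkovVI.IsGeometricLevels P ζ J →
      x0 ∈ X →
      1 ≤ b → 0 < γ →
      γ * (μF + μr) ≤ c →
      γ * L ≤ c →
      γ * (Δ ^ 2 * (τ / b) + Δ ^ 2 * (τ ^ 2 / b ^ 2)) ≤ c * (μF + μr) →
      γ ^ 2 * (Δ ^ 2 * (τ / b)) ≤ c →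
      2 ≤ M →
      a * max 2 (√(γ⁻¹ * (μF + μr)⁻¹)) ≤ M →
      M ≤ A * max 2 (√(γ⁻¹ * (μF + μr)⁻¹)) →
      B = ⌈b * Real.logb 2 M⌉₊ →
      -- the convergence guarantee
      ∀ N : ℕ,
        MeasureTheory.Integrable (fun ω =>
          ‖MarkovVI.egIterate X r G γ M B x0 (fun n => ζ n ω) (fun k => J k ω) N - xs‖ ^ 2) P ∧
        ∫ ω, ‖MarkovVI.egIterate X r G γ M B x0 (fun n => ζ n ω) (fun k => J k ω) N - xs‖ ^ 2 ∂P
          ≤ C * (Real.exp (-(N * (μF + μr) * γ / 2)) * ‖x0 - xs‖ ^ 2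
              + γ / (μF + μr) * (σ ^ 2 * (τ / b) + σ ^ 2 * (τ ^ 2 / b ^ 2))) := by
  have hK : 360 ≤ MarkovVI.noiseConst a := MarkovVI.noiseConst_ge
  -- The factor `2` in `C` comes from summing the geometric series of ratio `1 - γ(μF + μr)/2`.
  refine ⟨1 / (32 * MarkovVI.noiseConst a), 2 * MarkovVI.noiseConst a, by positivity,
    by positivity, ?_⟩
  intro d X F r xs x0 L μF μr σ Δ Z _ _ _ _ Q _ π _ τ G Ω _ P _ ζ J γ M b B hX _ hr hlsc hL hLip
    hμF hmono hμr hsc hμ hsol hζ hπ hQ hGm hGmean hGb hJ hx0 hb hγ hc1 hc2 hc3 _ hM haM _ hB N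
  have h : MarkovVI.RegularVI X F r xs L μF μr := ⟨hX, hr, hlsc, hLip, hmono, hsc, hsol⟩
  have hG : MarkovVI.IsOracle X F xs σ Δ π G := ⟨hGm, hGmean, hGb⟩
  have hb' : (1 : ℝ) ≤ b := by exact_mod_cast hb
  have hl1 : (1 : ℝ) ≤ MarkovVI.topLevel M := by
    exact_mod_cast (MarkovVI.two_pow_le_iff_le_topLevel hM 1).1 (by simpa using hM)
  have hblB : (b : ℝ) * MarkovVI.topLevel M ≤ B := by
    rw [hB]
    exact (mul_le_mul_of_nonneg_left (MarkovVI.topLevel_le_logb hM) (by positivity)).trans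
      (Nat.le_ceil _)
  -- Uses that at least one level is active, since `M ≥ 2`.
  have hbB : (b : ℝ) ≤ B := by nlinarith
  have hB1 : 1 ≤ B := by exact_mod_cast hb'.trans hbB
  have hMa : a ^ 2 ≤ γ * (μF + μr) * M ^ 2 := by
    have h1 : a * √(γ⁻¹ * (μF + μr)⁻¹) ≤ M :=
      (mul_le_mul_of_nonneg_left (le_max_right _ _) ha.le).trans haM
    have h2 := pow_le_pow_left₀ (by positivity) h1 2
    rw [mul_pow, Real.sq_sqrt (by positivity)] at h2
    have h3 := mul_le_mul_of_nonneg_left h2 (by positivity : 0 ≤ γ * (μF + μr))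
    refine le_trans (le_of_eq ?_) h3
    field_simp
  obtain ⟨R, hR⟩ := MarkovVI.exists_isAdaptedPoint_egIterate (M := M) h hG hγ.le hL.le hM hB1 hx0 N
  refine ⟨?_, ?_⟩
  · refine MarkovVI.integrable_of_abs_le (((h.measurable_egIterate hγ.le hGm hζ.measurable_path
      hJ.measurable_seq M B x0 N).sub_const xs).norm.pow_const 2) (s := R ^ 2) fun ω => ?_
    rw [abs_of_nonneg (sq_nonneg _)]
    exact pow_le_pow_left₀ (norm_nonneg _) ((hR _).norm_le _) 2
  set S := σ ^ 2 * (τ / b : ℝ) + σ ^ 2 * (τ ^ 2 / b ^ 2) with hS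
  have hS0 : 0 ≤ S := by positivity
  have hγμ : 0 < γ * (μF + μr) := by positivity
  have hsmall : γ * (μF + μr) ≤ 1 := by
    refine hc1.trans ?_
    rw [div_le_one (by positivity)]
    linarith
  have hrec : ∀ k, ∫ ω, ‖MarkovVI.egIterate X r G γ M B x0 (fun n => ζ n ω) (fun k => J k ω)
      (k + 1) - xs‖ ^ 2 ∂P ≤ (1 - γ * (μF + μr) / 2) * ∫ ω, ‖MarkovVI.egIterate X r G γ M B x0
      (fun n => ζ n ω) (fun k => J k ω) k - xs‖ ^ 2 ∂P + MarkovVI.noiseConst a * γ ^ 2 * S :=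
    fun k => MarkovVI.integral_egIterate_succ_le (M := M) h hG hζ.measurable hJ hγ.le hL.le hM hB1
      hx0 k
      fun T R ξ hξ => by
        have : IsProbabilityMeasure (P.map (J k)) :=
          Measure.isProbabilityMeasure_map (hJ.measurable k).aemeasurable
        obtain ⟨U, V, D, hUd, hU, hV, hD, hUVD, hW⟩ := MarkovVI.expected_descent h hG hζ hQ hπ
          (hJ.map_singleton k) hγ hL.le hμr hμ hM hB1 hξ
        rw [← hUd]
        exact MarkovVI.contraction_of_descent ha hγ hL.le hμF hμ (by positivity) hb' hM hbB hblB
          hMa hc1 hc2 hc3 hU hV hD hUVD hW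
  have hfin := MarkovVI.le_of_contraction (U := fun k => ∫ ω, ‖MarkovVI.egIterate X r G γ M B x0
    (fun n => ζ n ω) (fun k => J k ω) k - xs‖ ^ 2 ∂P) (by linarith) (by linarith)
    (by positivity) hrec N
  refine hfin.trans ?_
  have e0 : ∫ ω, ‖MarkovVI.egIterate X r G γ M B x0 (fun n => ζ n ω) (fun k => J k ω) 0
      - xs‖ ^ 2 ∂P = ‖x0 - xs‖ ^ 2 := by
    simp [MarkovVI.egIterate, MarkovVI.egState]
  have e1 : (1 - γ * (μF + μr) / 2) ^ N ≤ Real.exp (-(N * (μF + μr) * γ / 2)) := by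
    have h1 := pow_le_pow_left₀ (by linarith) (Real.one_sub_le_exp_neg (γ * (μF + μr) / 2)) N
    rw [← Real.exp_nat_mul] at h1
    refine h1.trans (le_of_eq ?_)
    congr 1
    ring
  have e2 : MarkovVI.noiseConst a * γ ^ 2 * S / (1 - (1 - γ * (μF + μr) / 2))
      = 2 * MarkovVI.noiseConst a * (γ / (μF + μr) * S) := by
    rw [sub_sub_cancel]
    field_simp
  rw [e0, e2, mul_add (2 * MarkovVI.noiseConst a)]
  have e3 := mul_le_mul_of_nonneg_right e1 (sq_nonneg ‖x0 - xs‖)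
  have e4 : 0 ≤ Real.exp (-(N * (μF + μr) * γ / 2)) * ‖x0 - xs‖ ^ 2 := by positivity
  have e5 := mul_le_mul_of_nonneg_right (by linarith : 1 ≤ 2 * MarkovVI.noiseConst a) e4
  linarith
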